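/- Let $d\ge 2$ and let $\mathcal M_d$ be the complex $d\times d$ matrices, $\mathcal D_d$ the density matrices (positive semidefinite, trace one), and $|\Omega\rangle=\frac1{\sqrt d}\sum_{i=1}^d|ii\rangle$. For a quantum channel (completely positive trace-preserving linear map) $T:\mathcal M_d\to\mathcal M_d\otimes\mathcal M_d$ let $T_1(\rho)=\mathrm{Tr}_2\,T(\rho)$ and $T_2(\rho)=\mathrm{Tr}_1\,T(\rho)$ be its marginals. Consider the figures of merit $$d^F(T_i,\mathrm{id})=\langle\Omega|(\mathrm{id}\otimes T_i)(|\Omega\rangle\langle\Omega|)|\Omega\rangle,\qquad d^1(T_i,\mathrm{id})=1-\tfrac12\sup_{\rho\in\mathcal D_d}\|T_i(\rho)-\rho\|_1,$$ $$d^2(T_i,\mathrm{id})=1-\sup_{\rho\in\mathcal D_d}\|T_i(\rho)-\rho\|_2,\qquad d^\infty(T_i,\mathrm{id})=1-\sup_{\rho\in\mathcal D_d}\|T_i(\rho)-\rho\|_\infty,$$ $$d^\diamond(T_i,\mathrm{id})=1-\tfrac12\sup_{\rho\in\mathcal D_{d^2}}\|(T_i\otimes\mathrm{id}_d)(\rho)-\rho\|_1,$$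 where $\|\cdot\|_1,\|\cdot\|_2,\|\cdot\|_\infty$ are the trace, Frobenius and operator norms. For $k\in\{F,1,2,\infty,\diamond\}$ let $$\mathcal C^k=\{(d^k(T_1,\mathrm{id}),d^k(T_2,\mathrm{id})) : T \text{ a quantum channel},\ d^k(T_1,\mathrm{id})\ge 0,\ d^k(T_2,\mathrm{id})\ge 0\}.$$ For $k\neq 2$ the two non-negativity conditions hold for every channel. Then for every $k$ $$\mathcal C^k=\mathrm{conv}\Big(\{(0,0)\}\cup\{x^{(k)}_{\max,1},x^{(k)}_{\max,2}\}\cup\{x\in\mathbb R^2: f^k(x_1),f^k(x_2)\ge 0,\ g(f^k(x_1),f^k(x_2))=0\}\Big),$$ where $$g(x_1,x_2)=\frac1{d+1}(\sqrt{x_1}+\sqrt{x_2})^2+\frac1{d-1}(\sqrt{x_1}-\sqrt{x_2})^2-\frac2d,$$ $$f^F(x)=f^\diamond(x)=x,\qquad f^1(x)=f^\infty(x)=1+\frac{1+d}{d}(x-1),\qquad f^2(x)=1+\frac{d^2-1}{d^2}\sqrt{\frac d{d-1}}\,(x-1),$$ and the two maximal points are $x^{(F)}_{\max,1}=(1,\frac1{d^2})$,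 $x^{(F)}_{\max,2}=(\frac1{d^2},1)$, and $x^{(k)}_{\max,1}=(1,0)$, $x^{(k)}_{\max,2}=(0,1)$ for $k=1,2,\infty,\diamond$. Both points lie in $\mathcal C^k$; no channel has $d^k(T_i,\mathrm{id})$ larger than the $i$-th coordinate of $x^{(k)}_{\max,i}$, which is $1$; and among the points of $\mathcal C^k$ whose $i$-th coordinate is $1$, the point $x^{(k)}_{\max,i}$ has the least other coordinate. -/

import Mathlib

namespace QuantumCloning

open scoped ComplexOrder

/-! ### States and channels -/

/-- The density matrices (quantum states) of a system with basis indexed by `m`. -/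
def densityMatrices (m : Type) [Fintype m] : Set (Matrix m m ℂ) :=
  {ρ | ρ.PosSemidef ∧ ρ.trace = 1}

/-- The action of `id ⊗ L` on matrices of the composite system `ι × m`: the map `L` is applied to
every `ι`-block. -/
def idTensor {m n : Type} (ι : Type) (L : Matrix m m ℂ →ₗ[ℂ] Matrix n n ℂ)
    (X : Matrix (ι × m) (ι × m) ℂ) : Matrix (ι × n) (ι × n) ℂ :=
  Matrix.of fun p q => L (Matrix.of fun a b => X (p.1, a) (q.1, b)) p.2 q.2

/-- Complete positivity: `id_r ⊗ L` preserves positive semidefiniteness for every ancilla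
dimension `r`. -/
def IsCompletelyPositive {m n : Type} [Fintype m] [Fintype n]
    (L : Matrix m m ℂ →ₗ[ℂ] Matrix n n ℂ) : Prop :=
  ∀ (r : ℕ) (X : Matrix (Fin r × m) (Fin r × m) ℂ), X.PosSemidef →
    (idTensor (Fin r) L X).PosSemidef

/-- A quantum channel: a completely positive and trace preserving linear map. -/
structure IsChannel {m n : Type} [Fintype m] [Fintype n]
    (L : Matrix m m ℂ →ₗ[ℂ] Matrix n n ℂ) : Prop where
  completelyPositive : IsCompletelyPositive L
  tracePreserving : ∀ X : Matrix m m ℂ, (L X).trace = X.trace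

/-- Partial trace over the second tensor factor. -/
def traceSnd (m n : Type) [Fintype n] : Matrix (m × n) (m × n) ℂ →ₗ[ℂ] Matrix m m ℂ where
  toFun X := Matrix.of fun i j => ∑ k, X (i, k) (j, k)
  map_add' X Y := by ext i j; simp [Finset.sum_add_distrib]
  map_smul' c X := by ext i j; simp [Finset.mul_sum]

/-- Partial trace over the first tensor factor. -/
def traceFst (m n : Type) [Fintype m] : Matrix (m × n) (m × n) ℂ →ₗ[ℂ] Matrix n n ℂ where
  toFun X := Matrix.of fun i j => ∑ k, X (k, i) (k, j)
  map_add' X Y := by ext i j; simp [Finset.sum_add_distrib]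
  map_smul' c X := by ext i j; simp [Finset.mul_sum]

/-- Linear maps from `M_d` to `M_d ⊗ M_d`. -/
abbrev CloningMap (d : ℕ) : Type :=
  Matrix (Fin d) (Fin d) ℂ →ₗ[ℂ] Matrix (Fin d × Fin d) (Fin d × Fin d) ℂ

/-- The marginal `T₁(ρ) = Tr₂ T(ρ)`. -/
def marginal₁ {d : ℕ} (T : CloningMap d) : Matrix (Fin d) (Fin d) ℂ →ₗ[ℂ] Matrix (Fin d) (Fin d) ℂ :=
  traceSnd (Fin d) (Fin d) ∘ₗ T

/-- The marginal `T₂(ρ) = Tr₁ T(ρ)`. -/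
def marginal₂ {d : ℕ} (T : CloningMap d) : Matrix (Fin d) (Fin d) ℂ →ₗ[ℂ] Matrix (Fin d) (Fin d) ℂ :=
  traceFst (Fin d) (Fin d) ∘ₗ T

/-! ### Norms -/

/-- The trace norm: the sum of the singular values (the square roots of the eigenvalues of
`Aᴴ * A`). -/
noncomputable def traceNorm {m : Type} [Fintype m] [DecidableEq m] (A : Matrix m m ℂ) : ℝ :=
  ∑ i, Real.sqrt ((Matrix.isHermitian_conjTranspose_mul_self A).eigenvalues i)

/-- The Frobenius norm. -/
noncomputable def frobeniusNorm {m : Type} [Fintype m] (A : Matrix m m ℂ) : ℝ :=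
  Real.sqrt (∑ i, ∑ j, ‖A i j‖ ^ 2)

/-- The operator norm of `A` acting on the Hilbert space `ℂ^m`. -/
noncomputable def operatorNorm {m : Type} [Fintype m] [DecidableEq m] (A : Matrix m m ℂ) : ℝ :=
  ‖Matrix.toEuclideanCLM (n := m) (𝕜 := ℂ) A‖

/-! ### Figures of merit -/

/-- The vector `|Ω⟩ = d^{-1/2} ∑ᵢ |ii⟩`. -/
noncomputable def omegaVec (d : ℕ) : Fin d × Fin d → ℂ :=
  fun p => if p.1 = p.2 then ((1 / Real.sqrt d : ℝ) : ℂ) else 0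

/-- The Choi matrix `(id ⊗ L)(|Ω⟩⟨Ω|)`. -/
noncomputable def choi {d : ℕ} (L : Matrix (Fin d) (Fin d) ℂ →ₗ[ℂ] Matrix (Fin d) (Fin d) ℂ) :
    Matrix (Fin d × Fin d) (Fin d × Fin d) ℂ :=
  idTensor (Fin d) L (Matrix.vecMulVec (omegaVec d) (star (omegaVec d)))

/-- The labels `F`, `1`, `2`, `∞`, `◇` of the five figures of merit. -/
inductive Merit
  | fidelity
  | trace
  | frobenius
  | operator
  | diamond

/-- The figure of merit `d^k(L, id)`. In the diamond case the ancilla is the first tensor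
factor; the trace norm does not depend on the order of the factors. -/
noncomputable def quality {d : ℕ} :
    Merit → (Matrix (Fin d) (Fin d) ℂ →ₗ[ℂ] Matrix (Fin d) (Fin d) ℂ) → ℝ
  | .fidelity, L => (star (omegaVec d) ⬝ᵥ (choi L).mulVec (omegaVec d)).re
  | .trace, L => 1 - 1 / 2 * ⨆ ρ : densityMatrices (Fin d), traceNorm (L ρ.1 - ρ.1)
  | .frobenius, L => 1 - ⨆ ρ : densityMatrices (Fin d), frobeniusNorm (L ρ.1 - ρ.1)
  | .operator, L => 1 - ⨆ ρ : densityMatrices (Fin d), operatorNorm (L ρ.1 - ρ.1)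
  | .diamond, L =>
      1 - 1 / 2 * ⨆ ρ : densityMatrices (Fin d × Fin d), traceNorm (idTensor (Fin d) L ρ.1 - ρ.1)

/-- The pair of clone qualities of a cloning map. -/
noncomputable def qualities {d : ℕ} (k : Merit) (T : CloningMap d) : ℝ × ℝ :=
  (quality k (marginal₁ T), quality k (marginal₂ T))

/-- The achievable region `C^k`: all pairs of (non-negative) clone qualities of quantum
channels `T : M_d → M_d ⊗ M_d`. -/
def region (d : ℕ) (k : Merit) : Set (ℝ × ℝ) :=
  {z | 0 ≤ z.1 ∧ 0 ≤ z.2 ∧ ∃ T : CloningMap d, IsChannel T ∧ qualities k T = z}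

/-! ### The closed form -/

/-- The fidelity boundary function `g`. -/
noncomputable def g (d : ℕ) (x₁ x₂ : ℝ) : ℝ :=
  1 / ((d : ℝ) + 1) * (Real.sqrt x₁ + Real.sqrt x₂) ^ 2
    + 1 / ((d : ℝ) - 1) * (Real.sqrt x₁ - Real.sqrt x₂) ^ 2 - 2 / (d : ℝ)

/-- The affine maps `f^k`. -/
noncomputable def f (d : ℕ) : Merit → ℝ → ℝ
  | .fidelity, x => x
  | .trace, x => 1 + (1 + (d : ℝ)) / d * (x - 1)
  | .frobenius, x => 1 + ((d : ℝ) ^ 2 - 1) / (d : ℝ) ^ 2 * Real.sqrt ((d : ℝ) / (d - 1)) * (x - 1)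
  | .operator, x => 1 + (1 + (d : ℝ)) / d * (x - 1)
  | .diamond, x => x

/-- The curve `g(f^k(x₁), f^k(x₂)) = 0`, on the set where the square roots in `g` are defined. -/
def curve (d : ℕ) (k : Merit) : Set (ℝ × ℝ) :=
  {x | 0 ≤ f d k x.1 ∧ 0 ≤ f d k x.2 ∧ g d (f d k x.1) (f d k x.2) = 0}

/-- The value of `d^k` for the second clone at the first maximal point. -/
noncomputable def otherQuality (d : ℕ) : Merit → ℝ
  | .fidelity => 1 / (d : ℝ) ^ 2
  | _ => 0

/-- The maximal point for the first clone. -/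
noncomputable def xmax₁ (d : ℕ) (k : Merit) : ℝ × ℝ := (1, otherQuality d k)

/-- The maximal point for the second clone. -/
noncomputable def xmax₂ (d : ℕ) (k : Merit) : ℝ × ℝ := (otherQuality d k, 1)

/-- The convex hull of the origin, the two maximal points and the curve. -/
def closedForm (d : ℕ) (k : Merit) : Set (ℝ × ℝ) :=
  convexHull ℝ ({(0, 0)} ∪ {xmax₁ d k, xmax₂ d k} ∪ curve d k)

end QuantumCloning

/-! The theorem is proved first for the entanglement fidelities and then transferred to the other
figures of merit.

Fidelity, necessity: the Choi state of `T` on reference and clones is a sum of rank-one terms `v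
v*`. The two fidelities are the weights of the `v` on the vectors `u k` (`Ω` between reference and
first clone, `e_k` on the second clone) and `w k` (roles of the clones exchanged). The planes
spanned by `u k, w k` are mutually orthogonal, and the overlap within each is `1/d`. Bessel's
inequality (`sum_inner_planes_le`) and Cauchy–Schwarz give `x + y - (2/d)√(xy) ≤ 1 - 1/d²`
(`qualities_fidelity_mem`), with equality exactly when `g = 0`.

Fidelity, sufficiency: the channels `cloner d a b` have depolarizing marginals and realise every
pair with `g = 0`. The left side of the inequality is homogeneous of degree one, so every admissible
pair is a contraction of a boundary pair towards the origin. It is reached by mixing with a channel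
of fidelities `(0, 0)`, since the fidelity is affine in the channel.

Other figures of merit: `f d k (quality k L) ≤ quality .fidelity L` for every channel `L`
(`f_quality_le`). For `k = 1, 2, ∞`, some pure state is transmitted with at most the average
pure-state fidelity, by a finite two-design, and the norms are bounded below by pairing with that
state; for `◇` the state `Ω` itself is used. Depolarizing channels satisfy the reverse inequality
(`le_f_quality`). Hence the boundary cloners are optimal for all `k` simultaneously.

A clone can be degraded on its own by mixing with a channel that resets it, so for `k ≠ F` the
region is the part of the quadrant below the curve, `dominatedSet`. Planar convexity identifies it
with the convex hull; the axis points `(1, 0)` and `(0, 1)` supply what lies below the curve. -/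

namespace QuantumCloning

open scoped ComplexOrder

/-! ### The planar geometry of the closed form -/

/-- The slope of the affine map `f d k`. -/
noncomputable def slope (d : ℕ) : Merit → ℝ
  | .fidelity => 1
  | .trace => (1 + (d : ℝ)) / d
  | .frobenius => ((d : ℝ) ^ 2 - 1) / (d : ℝ) ^ 2 * Real.sqrt ((d : ℝ) / (d - 1))
  | .operator => (1 + (d : ℝ)) / d
  | .diamond => 1

lemma f_eq_slope (d : ℕ) (k : Merit) (x : ℝ) : f d k x = 1 + slope d k * (x - 1) := by
  cases k <;> simp [f, slope]

/-- Slope at least one means `f d k 0 ≤ 0`. This puts the curve in the non-negative quadrant and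
lets a coordinate `0` be dominated by any fidelity. -/
lemma one_le_slope {d : ℕ} (hd : 2 ≤ d) (k : Merit) : 1 ≤ slope d k := by
  have h2 : (2 : ℝ) ≤ d := by exact_mod_cast hd
  have h1 : 1 ≤ (1 + (d : ℝ)) / d := by
    rw [le_div_iff₀ (by linarith)]; linarith
  cases k
  · exact le_rfl
  · exact h1
  · change 1 ≤ ((d : ℝ) ^ 2 - 1) / (d : ℝ) ^ 2 * Real.sqrt ((d : ℝ) / (d - 1))
    have hpos : 0 < ((d : ℝ) ^ 2 - 1) / (d : ℝ) ^ 2 := by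
      apply div_pos <;> nlinarith
    rw [← div_le_iff₀' hpos]
    apply Real.le_sqrt_of_sq_le
    have hd1 : (0 : ℝ) < d - 1 := by linarith
    have hd2 : (0 : ℝ) < (d : ℝ) ^ 2 - 1 := by nlinarith
    rw [one_div_div, div_pow, div_le_div_iff₀ (by positivity) hd1]
    -- This product is the difference of the two sides after clearing denominators.
    have : 0 ≤ (d : ℝ) * (d - 1) * ((d : ℝ) ^ 2 - d - 1) := by
      apply mul_nonneg (by nlinarith); nlinarith
    nlinarith
  · exact h1
  · exact le_rfl

/-- The set of pairs of entanglement fidelities compatible with cloning. -/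
def fidelitySet (d : ℕ) : Set (ℝ × ℝ) :=
  {z | 0 ≤ z.1 ∧ 0 ≤ z.2 ∧
    z.1 + z.2 - 2 / (d : ℝ) * (Real.sqrt z.1 * Real.sqrt z.2) ≤ 1 - 1 / (d : ℝ) ^ 2}

/-- The prefactor is positive, so `g` has the sign of the defect in the inequality that defines
`fidelitySet`. -/
lemma g_eq {d : ℕ} (hd : 2 ≤ d) {x y : ℝ} (hx : 0 ≤ x) (hy : 0 ≤ y) :
    g d x y = 2 * d / ((d : ℝ) ^ 2 - 1) *
      (x + y - 2 / (d : ℝ) * (Real.sqrt x * Real.sqrt y) - (1 - 1 / (d : ℝ) ^ 2)) := by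
  have h2 : (2 : ℝ) ≤ d := by exact_mod_cast hd
  have hd0 : (d : ℝ) ≠ 0 := by linarith
  have hd1 : (d : ℝ) - 1 ≠ 0 := by linarith
  have hd2 : (d : ℝ) + 1 ≠ 0 := by linarith
  have hd3 : (d : ℝ) ^ 2 - 1 ≠ 0 := by nlinarith
  unfold g
  obtain ⟨a, ha, rfl⟩ : ∃ a, 0 ≤ a ∧ a ^ 2 = x := ⟨√x, Real.sqrt_nonneg _, Real.sq_sqrt hx⟩
  obtain ⟨b, hb, rfl⟩ : ∃ b, 0 ≤ b ∧ b ^ 2 = y := ⟨√y, Real.sqrt_nonneg _, Real.sq_sqrt hy⟩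
  rw [Real.sqrt_sq ha, Real.sqrt_sq hb, show (d : ℝ) ^ 2 - 1 = (d - 1) * (d + 1) by ring]
  field_simp
  ring

lemma g_eq_zero_iff {d : ℕ} (hd : 2 ≤ d) {x y : ℝ} (hx : 0 ≤ x) (hy : 0 ≤ y) :
    g d x y = 0 ↔ x + y - 2 / (d : ℝ) * (Real.sqrt x * Real.sqrt y) = 1 - 1 / (d : ℝ) ^ 2 := by
  have h2 : (2 : ℝ) ≤ d := by exact_mod_cast hd
  have hd3 : 0 < (d : ℝ) ^ 2 - 1 := by nlinarith
  rw [g_eq hd hx hy, mul_eq_zero, or_iff_right (by positivity), sub_eq_zero]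

/-- Cauchy–Schwarz in the plane. It expresses concavity of the geometric mean, which makes
`fidelitySet` convex. -/
lemma mul_sqrt_add_le {x₁ x₂ y₁ y₂ a b : ℝ} (hx₁ : 0 ≤ x₁) (hx₂ : 0 ≤ x₂) (hy₁ : 0 ≤ y₁)
    (hy₂ : 0 ≤ y₂) (ha : 0 ≤ a) (hb : 0 ≤ b) :
    a * (√x₁ * √x₂) + b * (√y₁ * √y₂) ≤ √(a * x₁ + b * y₁) * √(a * x₂ + b * y₂) := by
  rw [← Real.sqrt_mul (x := a * x₁ + b * y₁) (by positivity)]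
  apply Real.le_sqrt_of_sq_le
  obtain ⟨p, hp, rfl⟩ : ∃ p, 0 ≤ p ∧ p ^ 2 = x₁ := ⟨√x₁, Real.sqrt_nonneg _, Real.sq_sqrt hx₁⟩
  obtain ⟨q, hq, rfl⟩ : ∃ p, 0 ≤ p ∧ p ^ 2 = x₂ := ⟨√x₂, Real.sqrt_nonneg _, Real.sq_sqrt hx₂⟩
  obtain ⟨r, hr, rfl⟩ : ∃ p, 0 ≤ p ∧ p ^ 2 = y₁ := ⟨√y₁, Real.sqrt_nonneg _, Real.sq_sqrt hy₁⟩
  obtain ⟨t, ht, rfl⟩ : ∃ p, 0 ≤ p ∧ p ^ 2 = y₂ := ⟨√y₂, Real.sqrt_nonneg _, Real.sq_sqrt hy₂⟩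
  rw [Real.sqrt_sq hp, Real.sqrt_sq hq, Real.sqrt_sq hr, Real.sqrt_sq ht]
  have := mul_nonneg (mul_nonneg ha hb) (sq_nonneg (p * t - q * r))
  nlinarith

lemma convex_fidelitySet (d : ℕ) : Convex ℝ (fidelitySet d) := by
  rintro ⟨x₁, x₂⟩ ⟨hx₁, hx₂, hx⟩ ⟨y₁, y₂⟩ ⟨hy₁, hy₂, hy⟩ a b ha hb hab
  dsimp only at hx₁ hx₂ hx hy₁ hy₂ hy
  refine ⟨by simp; positivity, by simp; positivity, ?_⟩
  simp only [Prod.smul_mk, Prod.mk_add_mk, smul_eq_mul]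
  have h := mul_le_mul_of_nonneg_left (mul_sqrt_add_le hx₁ hx₂ hy₁ hy₂ ha hb)
    (show (0 : ℝ) ≤ 2 / d by positivity)
  have h1 := mul_le_mul_of_nonneg_left hx ha
  have h2 := mul_le_mul_of_nonneg_left hy hb
  have h3 : a * (1 - 1 / (d : ℝ) ^ 2) + b * (1 - 1 / (d : ℝ) ^ 2) = 1 - 1 / (d : ℝ) ^ 2 := by
    rw [← add_mul, hab, one_mul]
  linarith

/-- Completing the square in `√z.1` makes the constraint explicit for fixed `z.2`: it bounds `z.2`
by one, forces `√z.1 = 1/d` when `z.2 = 1`, and locates the boundary. -/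
lemma fidelitySet_completed_square {d : ℕ} {z : ℝ × ℝ} (hz : z ∈ fidelitySet d) :
    (√z.1 - √z.2 / d) ^ 2 ≤ (1 - 1 / (d : ℝ) ^ 2) * (1 - z.2) := by
  obtain ⟨h1, h2, h⟩ := hz
  have e1 := Real.sq_sqrt h1
  have e2 := Real.sq_sqrt h2
  have : (√z.1 - √z.2 / d) ^ 2 = z.1 + z.2 / (d : ℝ) ^ 2 - 2 / (d : ℝ) * (√z.1 * √z.2) := by
    rw [sub_sq, div_pow, e1, e2]; ring
  rw [this]
  have : z.2 / (d : ℝ) ^ 2 = 1 / (d : ℝ) ^ 2 * z.2 := by ring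
  linarith

lemma one_sub_inv_sq_pos {d : ℕ} (hd : 2 ≤ d) : 0 < 1 - 1 / (d : ℝ) ^ 2 := by
  have h2 : (2 : ℝ) ≤ d := by exact_mod_cast hd
  have : 1 / (d : ℝ) ^ 2 < 1 := by rw [div_lt_one (by positivity)]; nlinarith
  linarith

lemma swap_mem_fidelitySet {d : ℕ} {z : ℝ × ℝ} (hz : z ∈ fidelitySet d) :
    z.swap ∈ fidelitySet d := by
  obtain ⟨h1, h2, h⟩ := hz
  refine ⟨h2, h1, ?_⟩
  simp only [Prod.fst_swap, Prod.snd_swap]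
  rw [mul_comm (√z.2)]
  linarith

lemma snd_le_one_of_mem_fidelitySet {d : ℕ} (hd : 2 ≤ d) {z : ℝ × ℝ} (hz : z ∈ fidelitySet d) :
    z.2 ≤ 1 := by
  have := (sq_nonneg _).trans (fidelitySet_completed_square hz)
  have := nonneg_of_mul_nonneg_right this (one_sub_inv_sq_pos hd)
  linarith

lemma fst_le_one_of_mem_fidelitySet {d : ℕ} (hd : 2 ≤ d) {z : ℝ × ℝ} (hz : z ∈ fidelitySet d) :
    z.1 ≤ 1 := snd_le_one_of_mem_fidelitySet hd (swap_mem_fidelitySet hz)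

lemma one_inv_sq_eq (d : ℕ) (hd : 2 ≤ d) :
    (1 : ℝ) + 1 / (d : ℝ) ^ 2 - 2 / (d : ℝ) * (√1 * √(1 / (d : ℝ) ^ 2)) = 1 - 1 / (d : ℝ) ^ 2 := by
  have h2 : (2 : ℝ) ≤ d := by exact_mod_cast hd
  rw [← one_div_pow, Real.sqrt_sq (by positivity), Real.sqrt_one]
  field_simp; ring

lemma one_inv_sq_mem_fidelitySet {d : ℕ} (hd : 2 ≤ d) : ((1 : ℝ), 1 / (d : ℝ) ^ 2) ∈ fidelitySet d :=
  ⟨zero_le_one, by positivity, (one_inv_sq_eq d hd).le⟩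

lemma zero_mem_fidelitySet {d : ℕ} (hd : 2 ≤ d) : ((0 : ℝ), (0 : ℝ)) ∈ fidelitySet d :=
  ⟨le_rfl, le_rfl, by simpa using (one_sub_inv_sq_pos hd).le⟩

lemma snd_eq_of_mem_fidelitySet {d : ℕ} {z : ℝ × ℝ} (hz : z ∈ fidelitySet d)
    (h : z.2 = 1) : z.1 = 1 / (d : ℝ) ^ 2 := by
  have h1 := fidelitySet_completed_square hz
  rw [h, sub_self, mul_zero] at h1
  have h2 := pow_eq_zero_iff two_ne_zero |>.1 (le_antisymm h1 (sq_nonneg _))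
  rw [Real.sqrt_one] at h2
  rw [← Real.sq_sqrt hz.1, sub_eq_zero.1 h2, div_pow, one_pow]

/-- Every pair of fidelities dominates, up to moving along the boundary, a boundary pair. -/
lemma exists_boundary_ge {d : ℕ} (hd : 2 ≤ d) {z : ℝ × ℝ} (hz : z ∈ fidelitySet d) {u v : ℝ}
    (hu : u ≤ z.1) (hv : v ≤ z.2) :
    ∃ p : ℝ × ℝ, u ≤ p.1 ∧ v ≤ p.2 ∧ 0 ≤ p.1 ∧ 0 ≤ p.2 ∧ g d p.1 p.2 = 0 := by
  have h2 : (2 : ℝ) ≤ d := by exact_mod_cast hd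
  have hz1 := fst_le_one_of_mem_fidelitySet hd hz
  have hz2 := snd_le_one_of_mem_fidelitySet hd hz
  have hc := one_sub_inv_sq_pos hd
  -- For small `v` the boundary point `(1, 1/d²)` already dominates, because no fidelity exceeds
  -- one.
  rcases le_total v (1 / (d : ℝ) ^ 2) with h | h
  · refine ⟨(1, 1 / (d : ℝ) ^ 2), hu.trans hz1, h, zero_le_one, by positivity, ?_⟩
    rw [g_eq_zero_iff hd zero_le_one (by positivity)]
    exact one_inv_sq_eq d hd
  -- Lower the second coordinate to `v` along the segment from `z` to `(1, 1/d²)`; the first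
  -- coordinate does not decrease, as `z.1 ≤ 1`.
  obtain ⟨w, hw, hzw⟩ : ∃ w, z.1 ≤ w ∧ (w, v) ∈ fidelitySet d := by
    rcases eq_or_lt_of_le (h.trans hv) with h' | h'
    · exact ⟨z.1, le_rfl, by rw [le_antisymm hv (h'.symm.le.trans h)]; exact hz⟩
    · set m := 1 / (d : ℝ) ^ 2
      set t := (v - m) / (z.2 - m)
      have hpos : 0 < z.2 - m := by linarith
      have ht0 : 0 ≤ t := div_nonneg (by linarith) hpos.le
      have ht1 : t ≤ 1 := by rw [div_le_one hpos]; linarith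
      refine ⟨t * z.1 + (1 - t) * 1, by nlinarith, ?_⟩
      have := convex_fidelitySet d hz (one_inv_sq_mem_fidelitySet hd) ht0 (sub_nonneg.2 ht1)
        (by ring)
      convert this using 1
      ext
      · simp
      · simp only [Prod.snd_add, Prod.smul_snd, smul_eq_mul]
        have : t * (z.2 - m) = v - m := div_mul_cancel₀ _ hpos.ne'
        change v = t * z.2 + (1 - t) * m
        linarith
  have hv0 : 0 ≤ v := hzw.2.1
  have hv1 : v ≤ 1 := hv.trans hz2
  have hsq := fidelitySet_completed_square hzw
  dsimp only at hsq
  set r := √((1 - 1 / (d : ℝ) ^ 2) * (1 - v))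
  have hr0 : 0 ≤ r := Real.sqrt_nonneg _
  have hr2 : r ^ 2 = (1 - 1 / (d : ℝ) ^ 2) * (1 - v) :=
    Real.sq_sqrt (mul_nonneg hc.le (by linarith))
  have hv' := Real.sq_sqrt hv0
  have hA0 : 0 ≤ √v / d + r := by positivity
  have hwA : √w ≤ √v / d + r := by
    have := (abs_le.1 (abs_le_of_sq_le_sq (hr2 ▸ hsq) hr0)).2
    linarith
  -- At height `v` the constraint on `√w` reads `|√w - √v/d| ≤ r`; its larger endpoint gives the
  -- boundary point.
  refine ⟨((√v / d + r) ^ 2, v), ?_, le_rfl, by positivity, hv0, ?_⟩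
  · refine (hu.trans hw).trans ?_
    rw [← Real.sq_sqrt (show 0 ≤ w from hzw.1)]
    exact pow_le_pow_left₀ (Real.sqrt_nonneg _) hwA 2
  · rw [g_eq_zero_iff hd (by positivity) hv0]
    dsimp only
    rw [Real.sqrt_sq hA0]
    have e : (√v / d + r) ^ 2 + v - 2 / (d : ℝ) * ((√v / d + r) * √v)
      = r ^ 2 + v - (√v) ^ 2 / (d : ℝ) ^ 2 := by field_simp; ring
    rw [e, hr2, hv']; ring

/-- The points with non-negative coordinates that are dominated by compatible fidelities. -/
def dominatedSet (d : ℕ) (k : Merit) : Set (ℝ × ℝ) :=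
  {x | 0 ≤ x.1 ∧ 0 ≤ x.2 ∧ ∃ z ∈ fidelitySet d, f d k x.1 ≤ z.1 ∧ f d k x.2 ≤ z.2}

lemma curve_subset_dominatedSet {d : ℕ} (hd : 2 ≤ d) (k : Merit) :
    curve d k ⊆ dominatedSet d k := by
  rintro ⟨x, y⟩ ⟨hx, hy, h⟩
  dsimp only at hx hy h
  have hs := one_le_slope hd k
  have key : ∀ x : ℝ, 0 ≤ f d k x → 0 ≤ x := fun x hx => by
    rw [f_eq_slope] at hx; by_contra! h'; nlinarith
  exact ⟨key x hx, key y hy, (f d k x, f d k y), ⟨hx, hy, ((g_eq_zero_iff hd hx hy).1 h).le⟩,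
    le_rfl, le_rfl⟩

lemma convex_dominatedSet (d : ℕ) (k : Merit) : Convex ℝ (dominatedSet d k) := by
  rintro x ⟨hx₁, hx₂, z, hz, hz₁, hz₂⟩ y ⟨hy₁, hy₂, w, hw, hw₁, hw₂⟩ a b ha hb hab
  have key : ∀ s t : ℝ, f d k (a * s + b * t) = a * f d k s + b * f d k t := fun s t => by
    simp only [f_eq_slope]
    linear_combination (slope d k - 1) * hab
  refine ⟨by simp; positivity, by simp; positivity, a • z + b • w,
    convex_fidelitySet d hz hw ha hb hab, ?_, ?_⟩
  · simp only [Prod.fst_add, Prod.smul_fst, smul_eq_mul, key]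
    gcongr
  · simp only [Prod.snd_add, Prod.smul_snd, smul_eq_mul, key]
    gcongr

lemma otherQuality_of_ne {d : ℕ} {k : Merit} (hk : k ≠ .fidelity) : otherQuality d k = 0 := by
  cases k <;> simp_all [otherQuality]

lemma f_one (d : ℕ) (k : Merit) : f d k 1 = 1 := by simp [f_eq_slope]

lemma f_zero_nonpos {d : ℕ} (hd : 2 ≤ d) (k : Merit) : f d k 0 ≤ 0 := by
  rw [f_eq_slope]; linarith [one_le_slope hd k]

lemma closedForm_subset_dominatedSet {d : ℕ} (hd : 2 ≤ d) (k : Merit) :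
    closedForm d k ⊆ dominatedSet d k := by
  refine convexHull_min ?_ (convex_dominatedSet d k)
  have h0 := f_zero_nonpos hd k
  have hm : (0 : ℝ) ≤ 1 / (d : ℝ) ^ 2 := by positivity
  have ho : 0 ≤ otherQuality d k ∧ f d k (otherQuality d k) ≤ 1 / (d : ℝ) ^ 2 := by
    by_cases hk : k = .fidelity
    · subst hk; exact ⟨hm, le_rfl⟩
    · rw [otherQuality_of_ne hk]; exact ⟨le_rfl, h0.trans hm⟩
  rintro x ((rfl | rfl | rfl) | hx)
  · exact ⟨le_rfl, le_rfl, _, zero_mem_fidelitySet hd, h0, h0⟩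
  · exact ⟨zero_le_one, ho.1, _, one_inv_sq_mem_fidelitySet hd, (f_one d k).le, ho.2⟩
  · exact ⟨ho.1, zero_le_one, _, swap_mem_fidelitySet (one_inv_sq_mem_fidelitySet hd), ho.2,
      (f_one d k).le⟩
  · exact curve_subset_dominatedSet hd k hx

lemma exists_curve_ge {d : ℕ} (hd : 2 ≤ d) (k : Merit) {x : ℝ × ℝ} (hx : x ∈ dominatedSet d k) :
    ∃ p ∈ curve d k, x.1 ≤ p.1 ∧ x.2 ≤ p.2 := by
  obtain ⟨-, -, z, hz, h₁, h₂⟩ := hx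
  obtain ⟨p, hp₁, hp₂, hp₃, hp₄, hp⟩ := exists_boundary_ge hd hz h₁ h₂
  have hs : 0 < slope d k := zero_lt_one.trans_le (one_le_slope hd k)
  have key : ∀ y : ℝ, f d k (1 + (y - 1) / slope d k) = y := fun y => by
    rw [f_eq_slope]; field_simp; ring
  have mono : ∀ x y : ℝ, f d k x ≤ y → x ≤ 1 + (y - 1) / slope d k := fun x y h => by
    rw [f_eq_slope] at h
    rw [← sub_le_iff_le_add', le_div_iff₀ hs]; linarith
  exact ⟨(1 + (p.1 - 1) / slope d k, 1 + (p.2 - 1) / slope d k),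
    by simp only [curve, Set.mem_ofPred_eq, key]; exact ⟨hp₃, hp₄, hp⟩, mono _ _ hp₁, mono _ _ hp₂⟩

/-- Each point of a rectangle is a vertical combination of two points on its horizontal edges, and
those are combinations of corners. -/
lemma mem_of_le_of_convex {K : Set (ℝ × ℝ)} (hK : Convex ℝ K) {a b : ℝ}
    (h0 : ((0 : ℝ), (0 : ℝ)) ∈ K) (h1 : (a, (0 : ℝ)) ∈ K) (h2 : ((0 : ℝ), b) ∈ K)
    (h3 : (a, b) ∈ K) {x y : ℝ} (hx : 0 ≤ x) (hxa : x ≤ a) (hy : 0 ≤ y) (hyb : y ≤ b) :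
    (x, y) ∈ K := by
  have seg : ∀ {c t : ℝ}, 0 ≤ t → t ≤ c → ∃ r, 0 ≤ r ∧ r ≤ 1 ∧ r * c = t := fun {c t} ht htc => by
    rcases eq_or_lt_of_le (ht.trans htc) with h | h
    · exact ⟨0, le_rfl, zero_le_one, by subst h; linarith⟩
    · exact ⟨t / c, by positivity, (div_le_one h).2 htc, div_mul_cancel₀ _ h.ne'⟩
  obtain ⟨r, hr0, hr1, rfl⟩ := seg hx hxa
  obtain ⟨s, hs0, hs1, rfl⟩ := seg hy hyb
  have e1 := hK h0 h1 (sub_nonneg.2 hr1) hr0 (by ring)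
  have e2 := hK h2 h3 (sub_nonneg.2 hr1) hr0 (by ring)
  have := hK e1 e2 (sub_nonneg.2 hs1) hs0 (by ring)
  convert this using 1
  ext
  · simp only [Prod.fst_add, Prod.smul_fst, smul_eq_mul]; ring
  · simp only [Prod.snd_add, Prod.smul_snd, smul_eq_mul]; ring

/-- For `k ≠ F` the maximal points lie on the axes, so the hull contains both axis projections of a
curve point and with them the rectangle below it. This fails for the fidelity, whose region is not
closed under lowering one coordinate. -/
lemma dominatedSet_subset_closedForm {d : ℕ} (hd : 2 ≤ d) {k : Merit} (hk : k ≠ .fidelity) :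
    dominatedSet d k ⊆ closedForm d k := by
  intro x hx
  obtain ⟨p, hp, h₁, h₂⟩ := exists_curve_ge hd k hx
  have hsub := subset_convexHull ℝ ({(0, 0)} ∪ {xmax₁ d k, xmax₂ d k} ∪ curve d k)
  have hK : Convex ℝ (closedForm d k) := convex_convexHull ℝ _
  have h00 : ((0 : ℝ), (0 : ℝ)) ∈ closedForm d k := hsub (by simp)
  have h10 : ((1 : ℝ), (0 : ℝ)) ∈ closedForm d k :=
    hsub (by simp [xmax₁, otherQuality_of_ne hk])
  have h01 : ((0 : ℝ), (1 : ℝ)) ∈ closedForm d k :=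
    hsub (by simp [xmax₂, otherQuality_of_ne hk])
  obtain ⟨hp₁, hp₂, z, hz, hz₁, hz₂⟩ := curve_subset_dominatedSet hd k hp
  have hs := one_le_slope hd k
  have le_one : ∀ y : ℝ, f d k y ≤ 1 → y ≤ 1 := fun y h => by
    rw [f_eq_slope] at h; by_contra! h'; nlinarith
  have q₁ := le_one _ (hz₁.trans (fst_le_one_of_mem_fidelitySet hd hz))
  have q₂ := le_one _ (hz₂.trans (snd_le_one_of_mem_fidelitySet hd hz))
  have e1 : (p.1, (0 : ℝ)) ∈ closedForm d k := by
    simpa using hK h00 h10 (sub_nonneg.2 q₁) hp₁ (by ring)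
  have e2 : ((0 : ℝ), p.2) ∈ closedForm d k := by
    simpa using hK h00 h01 (sub_nonneg.2 q₂) hp₂ (by ring)
  exact mem_of_le_of_convex hK h00 e1 e2 (hsub (Or.inr hp)) hx.1 h₁ hx.2.1 h₂

/-- A pair of compatible fidelities is a contraction of a boundary pair. -/
lemma exists_curve_smul {d : ℕ} (hd : 2 ≤ d) {z : ℝ × ℝ} (hz : z ∈ fidelitySet d) :
    ∃ p ∈ curve d .fidelity, ∃ t : ℝ, 0 ≤ t ∧ t ≤ 1 ∧ z = t • p := by
  have h2 : (2 : ℝ) ≤ d := by exact_mod_cast hd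
  have hc := one_sub_inv_sq_pos hd
  obtain ⟨x, y⟩ := z
  obtain ⟨hx, hy, h⟩ := hz
  dsimp only at hx hy h
  set c := 1 - 1 / (d : ℝ) ^ 2
  set q := x + y - 2 / (d : ℝ) * (√x * √y) with hq
  -- This form shows that `q` is non-negative and vanishes only at the origin, where any curve point
  -- serves with `t = 0`.
  have hq' : q = (√x - √y) ^ 2 + 2 * (1 - 1 / (d : ℝ)) * (√x * √y) := by
    rw [sub_sq, Real.sq_sqrt hx, Real.sq_sqrt hy]; ring
  have hd' : 0 < 1 - 1 / (d : ℝ) := by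
    have : 1 / (d : ℝ) < 1 := by rw [div_lt_one (by linarith)]; linarith
    linarith
  have hq0 : 0 ≤ q := by rw [hq']; positivity
  rcases eq_or_lt_of_le hq0 with h0 | h0
  · have hsq : (√x - √y) ^ 2 = 0 ∧ 2 * (1 - 1 / (d : ℝ)) * (√x * √y) = 0 := by
      rw [← add_eq_zero_iff_of_nonneg (by positivity) (by positivity), ← hq', ← h0]
    have hxy : √x = √y := sub_eq_zero.1 (pow_eq_zero_iff two_ne_zero |>.1 hsq.1)
    have hm := hsq.2
    rw [mul_eq_zero, or_iff_right (by positivity), hxy, Real.mul_self_sqrt hy] at hm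
    rw [hm, Real.sqrt_zero, Real.sqrt_eq_zero hx] at hxy
    refine ⟨(1, 1 / (d : ℝ) ^ 2), ⟨zero_le_one, by simp [f], ?_⟩, 0, le_rfl, zero_le_one, ?_⟩
    · exact (g_eq_zero_iff hd (x := 1) (y := 1 / (d : ℝ) ^ 2) zero_le_one (by positivity)).2
        (one_inv_sq_eq d hd)
    · simp [hm, hxy]
  -- Since `q` is homogeneous of degree one, scaling by `c / q` lands on the curve.
  · have hr : 0 < c / q := by positivity
    refine ⟨(c / q * x, c / q * y), ?_, q / c, by positivity, (div_le_one hc).2 h, ?_⟩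
    · have h₁ : 0 ≤ c / q * x := by positivity
      have h₂ : 0 ≤ c / q * y := by positivity
      refine ⟨h₁, h₂, (g_eq_zero_iff hd h₁ h₂).2 ?_⟩
      rw [Real.sqrt_mul hr.le, Real.sqrt_mul hr.le]
      have : √(c / q) * √x * (√(c / q) * √y) = c / q * (√x * √y) := by
        rw [mul_mul_mul_comm, Real.mul_self_sqrt hr.le]
      rw [this]
      have : c / q * x + c / q * y - 2 / (d : ℝ) * (c / q * (√x * √y)) = c / q * q := by
        rw [hq]; ring
      rw [this, div_mul_cancel₀ _ h0.ne']
    · ext <;> simp <;> field_simp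

lemma curve_fidelity_subset {d : ℕ} (hd : 2 ≤ d) : curve d .fidelity ⊆ fidelitySet d := by
  rintro ⟨x, y⟩ ⟨hx, hy, h⟩
  exact ⟨hx, hy, ((g_eq_zero_iff hd hx hy).1 h).le⟩

lemma closedForm_fidelity {d : ℕ} (hd : 2 ≤ d) : closedForm d .fidelity = fidelitySet d := by
  apply Set.Subset.antisymm
  · refine convexHull_min ?_ (convex_fidelitySet d)
    rintro x ((rfl | rfl | rfl) | hx)
    · exact zero_mem_fidelitySet hd
    · exact one_inv_sq_mem_fidelitySet hd
    · exact swap_mem_fidelitySet (one_inv_sq_mem_fidelitySet hd)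
    · exact curve_fidelity_subset hd hx
  · intro z hz
    obtain ⟨p, hp, t, ht0, ht1, rfl⟩ := exists_curve_smul hd hz
    have hsub := subset_convexHull ℝ
      ({(0, 0)} ∪ {xmax₁ d .fidelity, xmax₂ d .fidelity} ∪ curve d .fidelity)
    have hK : Convex ℝ (closedForm d .fidelity) := convex_convexHull ℝ _
    have := hK (hsub (Or.inl (Or.inl rfl))) (hsub (Or.inr hp)) (sub_nonneg.2 ht1) ht0 (by ring)
    rwa [Prod.mk_zero_zero, smul_zero, zero_add] at this

/-! ### Matrix norms -/

section Norms

variable {m : Type} [Fintype m]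

open scoped InnerProductSpace

lemma inner_self_toLp (x : m → ℂ) :
    ((‖WithLp.toLp 2 x‖ ^ 2 : ℝ) : ℂ) = star x ⬝ᵥ x := by
  have := inner_self_eq_norm_sq_to_K (𝕜 := ℂ) (WithLp.toLp 2 x : EuclideanSpace ℂ m)
  rw [EuclideanSpace.inner_toLp_toLp, dotProduct_comm] at this
  rw [this]
  simp

lemma frobeniusNorm_eq_norm (A : Matrix m m ℂ) :
    frobeniusNorm A = ‖WithLp.toLp 2 (fun p : m × m => A p.1 p.2)‖ := by
  rw [EuclideanSpace.norm_eq, frobeniusNorm, Fintype.sum_prod_type]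

variable [DecidableEq m]

lemma sum_inner_eq_trace {ι : Type*} [Fintype ι] (b : OrthonormalBasis ι ℂ (EuclideanSpace ℂ m))
    (A : Matrix m m ℂ) :
    ∑ i, ⟪b i, Matrix.toEuclideanCLM (n := m) (𝕜 := ℂ) A (b i)⟫_ℂ = A.trace := by
  have h := LinearMap.trace_eq_sum_inner
    (Matrix.toEuclideanCLM (n := m) (𝕜 := ℂ) A : EuclideanSpace ℂ m →ₗ[ℂ] EuclideanSpace ℂ m) b
  rw [Matrix.coe_toEuclideanCLM_eq_toEuclideanLin, Matrix.toEuclideanLin_eq_toLin_orthonormal,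
    Matrix.trace_toLin_eq] at h
  rw [h]
  simp only [← Matrix.toEuclideanLin_eq_toLin_orthonormal,
    ← Matrix.coe_toEuclideanCLM_eq_toEuclideanLin]
  rfl

lemma inner_toEuclideanCLM_eq (A : Matrix m m ℂ) (x y : m → ℂ) :
    ⟪WithLp.toLp 2 x, Matrix.toEuclideanCLM (n := m) (𝕜 := ℂ) A (WithLp.toLp 2 y)⟫_ℂ
      = star x ⬝ᵥ A.mulVec y := by
  rw [Matrix.toEuclideanCLM_toLp, EuclideanSpace.inner_toLp_toLp, dotProduct_comm]

/-- The right singular vectors of a matrix. -/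
noncomputable def singularBasis (A : Matrix m m ℂ) : OrthonormalBasis m ℂ (EuclideanSpace ℂ m) :=
  (Matrix.isHermitian_conjTranspose_mul_self A).eigenvectorBasis

/-- Moving `A` across gives `⟨e_i, Aᴴ A e_j⟩`, and `e_j` is an eigenvector of `Aᴴ A`. -/
lemma inner_singularBasis (A : Matrix m m ℂ) (i j : m) :
    ⟪Matrix.toEuclideanCLM (n := m) (𝕜 := ℂ) A (singularBasis A i),
      Matrix.toEuclideanCLM (n := m) (𝕜 := ℂ) A (singularBasis A j)⟫_ℂ =
      if i = j then ((Matrix.isHermitian_conjTranspose_mul_self A).eigenvalues i : ℂ) else 0 := by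
  have h := (Matrix.isHermitian_conjTranspose_mul_self A).mulVec_eigenvectorBasis j
  have h' : Matrix.toEuclideanCLM (n := m) (𝕜 := ℂ) (A.conjTranspose * A) (singularBasis A j) =
      ((Matrix.isHermitian_conjTranspose_mul_self A).eigenvalues j : ℂ) • singularBasis A j := by
    ext x
    have := congrFun h x
    simpa [Matrix.ofLp_toEuclideanCLM, singularBasis] using this
  rw [← ContinuousLinearMap.adjoint_inner_right, ← ContinuousLinearMap.star_eq_adjoint, ← map_star,
    Matrix.star_eq_conjTranspose, ← mul_apply_eq_comp, ← map_mul, h', inner_smul_right,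
    orthonormal_iff_ite.1 (singularBasis A).orthonormal]
  split_ifs with hij
  · simp [hij]
  · simp

lemma norm_singularBasis (A : Matrix m m ℂ) (i : m) :
    ‖Matrix.toEuclideanCLM (n := m) (𝕜 := ℂ) A (singularBasis A i)‖ =
      Real.sqrt ((Matrix.isHermitian_conjTranspose_mul_self A).eigenvalues i) := by
  have h := inner_singularBasis A i i
  rw [if_pos rfl, inner_self_eq_norm_sq_to_K] at h
  rw [← Real.sqrt_sq (norm_nonneg _)]
  congr 1
  exact Complex.ofReal_injective (by push_cast; exact h)

lemma traceNorm_eq_sum_norm (A : Matrix m m ℂ) : traceNorm A =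
    ∑ i, ‖Matrix.toEuclideanCLM (n := m) (𝕜 := ℂ) A (singularBasis A i)‖ := by
  simp only [norm_singularBasis, traceNorm]

/-- Evaluate the trace in the right singular basis of `A`. Together with attainment this is the
duality between trace norm and operator norm, from which the seminorm laws follow. -/
lemma re_trace_mul_le_traceNorm {W : Matrix m m ℂ} (hW : operatorNorm W ≤ 1) (A : Matrix m m ℂ) :
    (W * A).trace.re ≤ traceNorm A := by
  rw [← sum_inner_eq_trace (singularBasis A), traceNorm_eq_sum_norm, Complex.re_sum]
  refine Finset.sum_le_sum fun i _ => ?_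
  refine (Complex.re_le_norm _).trans ((norm_inner_le_norm _ _).trans ?_)
  rw [(singularBasis A).orthonormal.1 i, one_mul, map_mul, mul_apply_eq_comp]
  refine (ContinuousLinearMap.le_opNorm _ _).trans ?_
  exact mul_le_of_le_one_left (norm_nonneg _) hW

/-- The trace norm is attained as a pairing with a contraction. -/
lemma exists_re_trace_mul_eq_traceNorm (A : Matrix m m ℂ) :
    ∃ W : Matrix m m ℂ, operatorNorm W ≤ 1 ∧ (W * A).trace.re = traceNorm A := by
  classical
  set T := Matrix.toEuclideanCLM (n := m) (𝕜 := ℂ) A with hT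
  set e := singularBasis A
  -- `W` is the partial isometry taking the normalised `T (e i)` back to `e i`. The convention `0⁻¹
  -- = 0` drops the kernel directions, and Bessel's inequality makes `W` a contraction.
  set c : m → ℂ := fun i => ((‖T (e i)‖⁻¹ : ℝ) : ℂ)
  set Wc : EuclideanSpace ℂ m →L[ℂ] EuclideanSpace ℂ m :=
    ∑ i, InnerProductSpace.rankOne ℂ (e i) (c i • T (e i)) with hWc
  have hWc_apply : ∀ x, Wc x = ∑ i, ⟪c i • T (e i), x⟫_ℂ • e i := fun x => by
    simp [hWc, smul_smul, mul_comm]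
  have horth : Orthonormal ℂ (fun i : {i // T (e i) ≠ 0} => c i • T (e i)) := by
    rw [orthonormal_iff_ite]
    rintro ⟨i, hi⟩ ⟨j, hj⟩
    rw [inner_smul_left, inner_smul_right, inner_singularBasis]
    simp only [Subtype.mk.injEq]
    split_ifs with hij
    · subst hij
      have h := inner_singularBasis A i i
      rw [if_pos rfl] at h
      rw [← h, inner_self_eq_norm_sq_to_K]
      have : (‖T (e i)‖ : ℂ) ≠ 0 := by simpa using hi
      simp only [c, Complex.conj_ofReal]
      rw [Complex.ofReal_inv]
      change (‖T (e i)‖ : ℂ)⁻¹ * ((‖T (e i)‖ : ℂ)⁻¹ * (‖T (e i)‖ : ℂ) ^ 2) = 1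
      field_simp
    · simp
  refine ⟨(Matrix.toEuclideanCLM (n := m) (𝕜 := ℂ)).symm Wc, ?_, ?_⟩
  · rw [operatorNorm, StarAlgEquiv.apply_symm_apply]
    refine ContinuousLinearMap.opNorm_le_bound _ zero_le_one fun x => ?_
    rw [one_mul, ← sq_le_sq₀ (norm_nonneg _) (norm_nonneg _)]
    have h1 : ‖Wc x‖ ^ 2 = ∑ i, ‖⟪c i • T (e i), x⟫_ℂ‖ ^ 2 := by
      rw [← e.sum_sq_norm_inner_right (Wc x)]
      refine Finset.sum_congr rfl fun i _ => ?_
      rw [hWc_apply, e.orthonormal.inner_right_fintype]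
    rw [h1]
    have h2 := horth.sum_inner_products_le (s := Finset.univ) x
    rw [← Finset.sum_subtype (Finset.univ.filter fun i => T (e i) ≠ 0) (by simp)
      (fun i => ‖⟪c i • T (e i), x⟫_ℂ‖ ^ 2)] at h2
    rw [Finset.sum_filter] at h2
    refine (Finset.sum_le_sum fun i _ => ?_).trans h2
    split_ifs with h
    · exact le_rfl
    · simp [not_not.1 h]
  · rw [← sum_inner_eq_trace e, traceNorm_eq_sum_norm, Complex.re_sum]
    refine Finset.sum_congr rfl fun i _ => ?_
    rw [map_mul, mul_apply_eq_comp, StarAlgEquiv.apply_symm_apply, hWc_apply,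
      e.orthonormal.inner_right_fintype, inner_smul_left, ← hT, inner_self_eq_norm_sq_to_K]
    simp only [c, Complex.conj_ofReal]
    change ((‖T (e i)‖⁻¹ : ℝ) * (‖T (e i)‖ : ℂ) ^ 2).re = ‖T (e i)‖
    rw [← Complex.ofReal_pow, ← Complex.ofReal_mul, Complex.ofReal_re, sq]
    by_cases h : ‖T (e i)‖ = 0
    · simp [h]
    · rw [inv_mul_cancel_left₀ h]

lemma operatorNorm_neg (W : Matrix m m ℂ) : operatorNorm (-W) = operatorNorm W := by
  simp [operatorNorm]

lemma traceNorm_add_le (A B : Matrix m m ℂ) :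
    traceNorm (A + B) ≤ traceNorm A + traceNorm B := by
  obtain ⟨W, hW, h⟩ := exists_re_trace_mul_eq_traceNorm (A + B)
  rw [← h, Matrix.mul_add, Matrix.trace_add, Complex.add_re]
  exact add_le_add (re_trace_mul_le_traceNorm hW A) (re_trace_mul_le_traceNorm hW B)

lemma traceNorm_smul (r : ℝ) (A : Matrix m m ℂ) : traceNorm (r • A) = |r| * traceNorm A := by
  have key : ∀ (r : ℝ) (A : Matrix m m ℂ), traceNorm (r • A) ≤ |r| * traceNorm A := by
    intro r A
    obtain ⟨W, hW, h⟩ := exists_re_trace_mul_eq_traceNorm (r • A)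
    rw [← h, Matrix.mul_smul, Matrix.trace_smul, Complex.smul_re, smul_eq_mul]
    have h1 := re_trace_mul_le_traceNorm hW A
    have h2 := re_trace_mul_le_traceNorm ((operatorNorm_neg W).le.trans hW) A
    rw [Matrix.neg_mul, Matrix.trace_neg, Complex.neg_re] at h2
    refine (le_abs_self _).trans ?_
    rw [abs_mul]
    exact mul_le_mul_of_nonneg_left (abs_le.2 ⟨by linarith, h1⟩) (abs_nonneg _)
  refine le_antisymm (key r A) ?_
  rcases eq_or_ne r 0 with rfl | hr
  · rw [abs_zero, zero_mul]
    exact Finset.sum_nonneg fun _ _ => Real.sqrt_nonneg _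
  · have := key r⁻¹ (r • A)
    rwa [smul_smul, inv_mul_cancel₀ hr, one_smul, abs_inv, ← div_eq_inv_mul,
      le_div_iff₀' (abs_pos.2 hr)] at this

/-- The trace norm as a seminorm. -/
noncomputable def traceSeminorm (m : Type) [Fintype m] [DecidableEq m] :
    Seminorm ℝ (Matrix m m ℂ) :=
  Seminorm.of traceNorm traceNorm_add_le traceNorm_smul

/-- The operator norm as a seminorm. -/
noncomputable def operatorSeminorm (m : Type) [Fintype m] [DecidableEq m] :
    Seminorm ℝ (Matrix m m ℂ) :=
  Seminorm.of operatorNorm (fun A B => by rw [operatorNorm, map_add]; exact norm_add_le _ _)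
    (fun r A => by
      rw [operatorNorm, ← Complex.coe_smul, map_smul, norm_smul]; simp [operatorNorm])

/-- The Frobenius norm as a seminorm. -/
noncomputable def frobeniusSeminorm (m : Type) [Fintype m] [DecidableEq m] :
    Seminorm ℝ (Matrix m m ℂ) :=
  Seminorm.of frobeniusNorm
    (fun A B => by
      simp only [frobeniusNorm_eq_norm]
      exact norm_add_le (WithLp.toLp 2 (fun p : m × m => A p.1 p.2))
        (WithLp.toLp 2 (fun p : m × m => B p.1 p.2)))
    (fun r A => by
      simp only [frobeniusNorm_eq_norm]
      exact norm_smul r (WithLp.toLp 2 (fun p : m × m => A p.1 p.2)))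

/-- Split `A` into rank-one terms `v v*`; each contributes `Re ⟨v, W v⟩ ≤ ‖v‖²`. -/
lemma re_trace_mul_le_of_posSemidef {W A : Matrix m m ℂ} (hW : operatorNorm W ≤ 1)
    (hA : A.PosSemidef) : (W * A).trace.re ≤ A.trace.re := by
  obtain ⟨n, v, rfl⟩ := Matrix.posSemidef_iff_eq_sum_vecMulVec.1 hA
  rw [Matrix.mul_sum, Matrix.trace_sum, Matrix.trace_sum, Complex.re_sum, Complex.re_sum]
  refine Finset.sum_le_sum fun i _ => ?_
  rw [Matrix.mul_vecMulVec, Matrix.trace_vecMulVec, Matrix.trace_vecMulVec, dotProduct_comm,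
    dotProduct_comm (v i), ← inner_toEuclideanCLM_eq, ← inner_self_toLp, Complex.ofReal_re]
  refine (Complex.re_le_norm _).trans ((norm_inner_le_norm _ _).trans ?_)
  rw [sq]
  refine mul_le_mul_of_nonneg_left ?_ (norm_nonneg _)
  refine (ContinuousLinearMap.le_opNorm _ _).trans ?_
  exact mul_le_of_le_one_left (norm_nonneg _) hW

lemma traceNorm_sub_le {A B : Matrix m m ℂ} (hA : A.PosSemidef) (hB : B.PosSemidef) :
    traceNorm (A - B) ≤ A.trace.re + B.trace.re := by
  obtain ⟨W, hW, h⟩ := exists_re_trace_mul_eq_traceNorm (A - B)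
  rw [← h, Matrix.mul_sub, Matrix.trace_sub, Complex.sub_re]
  have h1 := re_trace_mul_le_of_posSemidef hW hA
  have h2 := re_trace_mul_le_of_posSemidef ((operatorNorm_neg W).le.trans hW) hB
  rw [Matrix.neg_mul, Matrix.trace_neg, Complex.neg_re] at h2
  linarith

/-- Pair `X` with the reflection `2 x x* - 1`, an isometry; the identity part drops out because `X`
is traceless. -/
lemma two_mul_le_traceNorm {X : Matrix m m ℂ} (hX : X.trace = 0) {x : m → ℂ}
    (hx : star x ⬝ᵥ x = 1) : 2 * (star x ⬝ᵥ X.mulVec x).re ≤ traceNorm X := by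
  have hn : ‖WithLp.toLp 2 x‖ = 1 := by
    have := inner_self_toLp x
    rw [hx] at this
    have h2 : ‖WithLp.toLp 2 x‖ ^ 2 = 1 := by exact_mod_cast this
    exact (pow_eq_one_iff_of_nonneg (norm_nonneg _) two_ne_zero).1 h2
  have hW : operatorNorm ((2 : ℂ) • Matrix.vecMulVec x (star x) - 1) ≤ 1 := by
    refine ContinuousLinearMap.opNorm_le_bound _ zero_le_one fun y => ?_
    rw [one_mul, ← sq_le_sq₀ (norm_nonneg _) (norm_nonneg _)]
    have : Matrix.toEuclideanCLM (n := m) (𝕜 := ℂ) ((2 : ℂ) • Matrix.vecMulVec x (star x) - 1) y =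
        (2 * ⟪WithLp.toLp 2 x, y⟫_ℂ) • WithLp.toLp 2 x - y := by
      ext i
      obtain ⟨y⟩ := y
      rw [EuclideanSpace.inner_toLp_toLp, Matrix.ofLp_toEuclideanCLM]
      simp [Matrix.sub_mulVec, Matrix.smul_mulVec, Matrix.vecMulVec_mulVec, dotProduct_comm]
      ring
    rw [this, norm_sub_sq (𝕜 := ℂ), norm_smul, hn, inner_smul_left]
    have e : (starRingEnd ℂ) (2 * ⟪WithLp.toLp 2 x, y⟫_ℂ) * ⟪WithLp.toLp 2 x, y⟫_ℂ =
        ((2 * ‖⟪WithLp.toLp 2 x, y⟫_ℂ‖ ^ 2 : ℝ) : ℂ) := by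
      rw [map_mul, mul_assoc, Complex.conj_mul', Complex.conj_ofNat]
      push_cast
      rfl
    rw [e, RCLike.re_eq_complex_re, Complex.ofReal_re, norm_mul, Complex.norm_ofNat]
    linarith
  refine le_trans (le_of_eq ?_) (re_trace_mul_le_traceNorm hW X)
  rw [Matrix.sub_mul, Matrix.trace_sub, Matrix.one_mul, hX, sub_zero, Matrix.smul_mul,
    Matrix.trace_smul, Matrix.trace_mul_comm, Matrix.mul_vecMulVec, Matrix.trace_vecMulVec,
    dotProduct_comm]
  simp

lemma re_le_operatorNorm (X : Matrix m m ℂ) {x : m → ℂ} (hx : star x ⬝ᵥ x = 1) :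
    (star x ⬝ᵥ X.mulVec x).re ≤ operatorNorm X := by
  have h2 : ‖WithLp.toLp 2 x‖ ^ 2 = 1 := by
    have := inner_self_toLp x
    rw [hx] at this
    exact_mod_cast this
  rw [← inner_toEuclideanCLM_eq]
  refine (Complex.re_le_norm _).trans ((norm_inner_le_norm _ _).trans ?_)
  have := ContinuousLinearMap.le_opNorm (Matrix.toEuclideanCLM (n := m) (𝕜 := ℂ) X)
    (WithLp.toLp 2 x)
  calc _ ≤ ‖WithLp.toLp 2 x‖ * (operatorNorm X * ‖WithLp.toLp 2 x‖) :=
        mul_le_mul_of_nonneg_left this (norm_nonneg _)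
    _ = operatorNorm X * ‖WithLp.toLp 2 x‖ ^ 2 := by ring
    _ = operatorNorm X := by rw [h2, mul_one]

/-- The norm of a Hermitian operator is the supremum of its absolute Rayleigh quotients. -/
lemma operatorNorm_le {X : Matrix m m ℂ} (hX : X.IsHermitian) {r : ℝ} (hr : 0 ≤ r)
    (h1 : ((r : ℂ) • (1 : Matrix m m ℂ) - X).PosSemidef)
    (h2 : ((r : ℂ) • (1 : Matrix m m ℂ) + X).PosSemidef) : operatorNorm X ≤ r := by
  have hs : (Matrix.toEuclideanCLM (n := m) (𝕜 := ℂ) X).toLinearMap.IsSymmetric := by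
    rw [Matrix.coe_toEuclideanCLM_eq_toEuclideanLin]
    exact Matrix.isSymmetric_toEuclideanLin_iff.2 hX
  rw [operatorNorm, ContinuousLinearMap.norm_eq_iSup_rayleighQuotient _ hs]
  refine ciSup_le fun x => ?_
  obtain ⟨x⟩ := x
  rw [ContinuousLinearMap.rayleighQuotient, ContinuousLinearMap.reApplyInnerSelf_apply,
    inner_re_symm, inner_toEuclideanCLM_eq]
  have hn := inner_self_toLp x
  have h1' := (Complex.le_def.1 (h1.dotProduct_mulVec_nonneg x)).1
  have h2' := (Complex.le_def.1 (h2.dotProduct_mulVec_nonneg x)).1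
  rw [Matrix.sub_mulVec, Matrix.smul_mulVec, Matrix.one_mulVec, dotProduct_sub, dotProduct_smul,
    ← hn] at h1'
  rw [Matrix.add_mulVec, Matrix.smul_mulVec, Matrix.one_mulVec, dotProduct_add, dotProduct_smul,
    ← hn] at h2'
  simp only [smul_eq_mul, Complex.sub_re, Complex.add_re, Complex.re_ofReal_mul,
    Complex.ofReal_re, Complex.zero_re] at h1' h2'
  rcases eq_or_lt_of_le (sq_nonneg ‖WithLp.toLp 2 x‖) with h0 | h0
  · rw [← h0]; simpa using hr
  · rw [abs_div, abs_of_pos h0, div_le_iff₀ h0]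
    exact abs_le.2 ⟨by simp only [RCLike.re_eq_complex_re]; linarith, by
      simp only [RCLike.re_eq_complex_re]; linarith⟩

end Norms

/-! ### Channels -/

section Channels

variable {m n k : Type} [Fintype m] [Fintype n] [Fintype k]

/-- If `L` has Kraus operators `K i`, then `id ⊗ L` has Kraus operators `1 ⊗ K i`, and conjugation
preserves positivity. -/
lemma isCompletelyPositive_of_kraus {κ : Type} [Fintype κ]
    (L : Matrix m m ℂ →ₗ[ℂ] Matrix n n ℂ) (K : κ → Matrix n m ℂ)
    (hL : ∀ X, L X = ∑ i, K i * X * (K i).conjTranspose) : IsCompletelyPositive L := by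
  classical
  intro r X hX
  have : idTensor (Fin r) L X = ∑ i,
      (Matrix.of fun (p : Fin r × n) (q : Fin r × m) => if p.1 = q.1 then K i p.2 q.2 else 0) * X *
      (Matrix.of fun (p : Fin r × n) (q : Fin r × m) =>
        if p.1 = q.1 then K i p.2 q.2 else 0).conjTranspose := by
    ext ⟨a, i⟩ ⟨b, j⟩
    simp only [idTensor, hL, Matrix.of_apply, Matrix.sum_apply, Matrix.mul_apply,
      Matrix.conjTranspose_apply, Fintype.sum_prod_type, ite_mul, zero_mul, Finset.sum_ite_irrel,
      Finset.sum_const_zero, Finset.sum_ite_eq, Finset.mem_univ, if_true, apply_ite star, star_zero,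
      mul_ite, mul_zero]
  rw [this]
  exact Matrix.posSemidef_sum _ fun i _ => hX.mul_mul_conjTranspose_same _

lemma IsCompletelyPositive.comp {L : Matrix n n ℂ →ₗ[ℂ] Matrix k k ℂ}
    {M : Matrix m m ℂ →ₗ[ℂ] Matrix n n ℂ} (hL : IsCompletelyPositive L)
    (hM : IsCompletelyPositive M) : IsCompletelyPositive (L ∘ₗ M) :=
  fun r X hX => hL r _ (hM r X hX)

lemma IsChannel.comp {L : Matrix n n ℂ →ₗ[ℂ] Matrix k k ℂ}
    {M : Matrix m m ℂ →ₗ[ℂ] Matrix n n ℂ} (hL : IsChannel L) (hM : IsChannel M) :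
    IsChannel (L ∘ₗ M) :=
  ⟨hL.1.comp hM.1, fun X => by rw [LinearMap.comp_apply, hL.2, hM.2]⟩

lemma IsChannel.convex {L M : Matrix m m ℂ →ₗ[ℂ] Matrix n n ℂ} (hL : IsChannel L)
    (hM : IsChannel M) {s t : ℝ} (hs : 0 ≤ s) (ht : 0 ≤ t) (hst : s + t = 1) :
    IsChannel (s • L + t • M) := by
  constructor
  · intro r X hX
    have : idTensor (Fin r) (s • L + t • M) X =
        s • idTensor (Fin r) L X + t • idTensor (Fin r) M X := by
      ext p q; simp [idTensor]
    rw [this]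
    exact ((hL.1 r X hX).smul hs).add ((hM.1 r X hX).smul ht)
  · intro X
    rw [LinearMap.add_apply, LinearMap.smul_apply, LinearMap.smul_apply, Matrix.trace_add,
      Matrix.trace_smul, Matrix.trace_smul, hL.2, hM.2, ← add_smul, hst, one_smul]

lemma IsCompletelyPositive.posSemidef {L : Matrix m m ℂ →ₗ[ℂ] Matrix n n ℂ}
    (hL : IsCompletelyPositive L) {X : Matrix m m ℂ} (hX : X.PosSemidef) : (L X).PosSemidef :=
  (hL 1 _ (hX.submatrix (Prod.snd : Fin 1 × m → m))).submatrix (fun i => ((0 : Fin 1), i))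

lemma IsChannel.mem_densityMatrices {L : Matrix m m ℂ →ₗ[ℂ] Matrix n n ℂ} (hL : IsChannel L)
    {ρ : Matrix m m ℂ} (hρ : ρ ∈ densityMatrices m) : L ρ ∈ densityMatrices n :=
  ⟨hL.1.posSemidef hρ.1, (hL.2 ρ).trans hρ.2⟩

lemma trace_idTensor {ι : Type} [Fintype ι] {L : Matrix m m ℂ →ₗ[ℂ] Matrix n n ℂ}
    (hL : ∀ X, (L X).trace = X.trace) (X : Matrix (ι × m) (ι × m) ℂ) :
    (idTensor ι L X).trace = X.trace := by
  have := fun i => hL (Matrix.of fun a b => X (i, a) (i, b))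
  simp only [Matrix.trace, Matrix.diag_apply, Fintype.sum_prod_type, Matrix.of_apply] at this ⊢
  exact Finset.sum_congr rfl fun i _ => this i

lemma IsChannel.idTensor_mem_densityMatrices {L : Matrix m m ℂ →ₗ[ℂ] Matrix n n ℂ}
    (hL : IsChannel L) {r : ℕ} {ρ : Matrix (Fin r × m) (Fin r × m) ℂ}
    (hρ : ρ ∈ densityMatrices (Fin r × m)) : idTensor (Fin r) L ρ ∈ densityMatrices (Fin r × n) :=
  ⟨hL.1 r ρ hρ.1, (trace_idTensor hL.2 ρ).trans hρ.2⟩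

lemma isChannel_traceSnd : IsChannel (traceSnd m n) := by
  constructor
  · intro r X hX
    have : idTensor (Fin r) (traceSnd m n) X =
        ∑ j, X.submatrix (fun p => (p.1, p.2, j)) (fun p => (p.1, p.2, j)) := by
      ext p q; simp [idTensor, traceSnd, Matrix.sum_apply]
    rw [this]
    exact Matrix.posSemidef_sum _ fun j _ => hX.submatrix _
  · intro X
    simp [Matrix.trace, traceSnd, Fintype.sum_prod_type]

/-- Exchanging the two tensor factors. -/
def swapFactors (m n : Type) : Matrix (m × n) (m × n) ℂ →ₗ[ℂ] Matrix (n × m) (n × m) ℂ where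
  toFun X := X.submatrix Prod.swap Prod.swap
  map_add' _ _ := rfl
  map_smul' _ _ := rfl

lemma isChannel_swapFactors : IsChannel (swapFactors m n) := by
  constructor
  · intro r X hX
    exact hX.submatrix (fun p : Fin r × n × m => (p.1, p.2.swap))
  · intro X
    simp only [Matrix.trace, Matrix.diag_apply, swapFactors, Fintype.sum_prod_type]
    exact Finset.sum_comm

/-- Discarding the first tensor factor and replacing it by the basis state `z`. -/
def resetFst [DecidableEq m] (z : m) : Matrix (m × n) (m × n) ℂ →ₗ[ℂ] Matrix (m × n) (m × n) ℂ where
  toFun X := Matrix.of fun p q => if p.1 = z ∧ q.1 = z then traceFst m n X p.2 q.2 else 0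
  map_add' X Y := by
    ext p q
    simp only [map_add, Matrix.add_apply, Matrix.of_apply]
    split_ifs <;> simp
  map_smul' c X := by
    ext p q
    simp only [map_smul, Matrix.smul_apply, Matrix.of_apply, RingHom.id_apply]
    split_ifs <;> simp

lemma isChannel_resetFst [DecidableEq m] (z : m) : IsChannel (resetFst (n := n) z) := by
  classical
  constructor
  · refine isCompletelyPositive_of_kraus (κ := m) _ (fun k => Matrix.of fun p q =>
      if p.1 = z then if q.1 = k then if p.2 = q.2 then 1 else 0 else 0 else 0) fun X => ?_
    ext ⟨a, i⟩ ⟨b, j⟩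
    simp only [resetFst, traceFst, LinearMap.coe_mk, AddHom.coe_mk, Matrix.of_apply,
      Matrix.sum_apply, Matrix.mul_apply,
      Matrix.conjTranspose_apply, Fintype.sum_prod_type, ite_mul, zero_mul, one_mul,
      Finset.sum_ite_irrel, Finset.sum_const_zero, Finset.sum_ite_eq, Finset.sum_ite_eq',
      Finset.mem_univ, if_true, apply_ite star, star_zero, star_one, mul_ite, mul_zero, mul_one]
    by_cases ha : a = z <;> by_cases hb : b = z <;> simp [ha, hb]
  · intro X
    simp only [Matrix.trace, Matrix.diag_apply, resetFst, traceFst, LinearMap.coe_mk,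
      AddHom.coe_mk, Matrix.of_apply, Fintype.sum_prod_type, and_self, Finset.sum_ite_irrel,
      Finset.sum_const_zero, Finset.sum_ite_eq', Finset.mem_univ, if_true]
    exact Finset.sum_comm

/-- The channel with constant output the basis state `z`. -/
def constantMap [DecidableEq m] (z : m) : Matrix m m ℂ →ₗ[ℂ] Matrix m m ℂ :=
  (Matrix.traceLinearMap m ℂ ℂ).smulRight (Matrix.single z z 1)

lemma constantMap_apply [DecidableEq m] (z : m) (X : Matrix m m ℂ) :
    constantMap z X = X.trace • Matrix.single z z 1 := rfl

lemma single_mem_densityMatrices [DecidableEq m] (z : m) :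
    Matrix.single z z (1 : ℂ) ∈ densityMatrices m := by
  refine ⟨?_, Matrix.trace_single_eq_same z 1⟩
  have : Matrix.single z z (1 : ℂ) =
      Matrix.vecMulVec (Pi.single z 1) (star (Pi.single z 1)) := by
    rw [Matrix.single_eq_single_vecMulVec_single]
    congr 1
    ext i
    by_cases h : i = z
    · subst h; simp
    · simp [h]
  rw [this]
  exact Matrix.posSemidef_vecMulVec_self_star _

lemma isChannel_constantMap [DecidableEq m] (z : m) : IsChannel (constantMap z) := by
  constructor
  · refine isCompletelyPositive_of_kraus _ (fun k => Matrix.single z k 1) fun X => ?_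
    simp only [Matrix.conjTranspose_single, star_one, Matrix.single_mul_mul_single, one_mul,
      mul_one, constantMap_apply, Matrix.trace, Matrix.diag_apply, Finset.sum_smul,
      Matrix.smul_single, smul_eq_mul]
  · intro X
    rw [constantMap_apply, Matrix.trace_smul, Matrix.trace_single_eq_same, smul_eq_mul, mul_one]

end Channels

/-! ### Cloning channels and their marginals -/

section Cloning

variable {d : ℕ}

lemma marginal₁_swapFactors (T : CloningMap d) :
    marginal₁ (swapFactors (Fin d) (Fin d) ∘ₗ T) = marginal₂ T := rfl

lemma IsChannel.marginal₁ {T : CloningMap d} (hT : IsChannel T) : IsChannel (marginal₁ T) :=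
  isChannel_traceSnd.comp hT

lemma IsChannel.marginal₂ {T : CloningMap d} (hT : IsChannel T) : IsChannel (marginal₂ T) := by
  rw [← marginal₁_swapFactors]
  exact (isChannel_swapFactors.comp hT).marginal₁

lemma marginal₁_combination (s t : ℝ) (T T' : CloningMap d) :
    marginal₁ (s • T + t • T') = s • marginal₁ T + t • marginal₁ T' := by
  ext; simp [marginal₁, traceSnd, Finset.sum_add_distrib, Finset.mul_sum]

lemma marginal₂_combination (s t : ℝ) (T T' : CloningMap d) :
    marginal₂ (s • T + t • T') = s • marginal₂ T + t • marginal₂ T' := by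
  ext; simp [marginal₂, traceFst, Finset.sum_add_distrib, Finset.mul_sum]

/-- Resetting the first clone leaves the second untouched; this is what lets one quality be lowered
independently. -/
lemma marginal₂_resetFst (z : Fin d) (T : CloningMap d) :
    marginal₂ (resetFst z ∘ₗ T) = marginal₂ T := by
  apply LinearMap.ext; intro X
  ext i j
  simp [marginal₂, traceFst, resetFst]

lemma marginal₁_resetFst (z : Fin d) {T : CloningMap d} (hT : IsChannel T) :
    marginal₁ (resetFst z ∘ₗ T) = constantMap z := by
  apply LinearMap.ext; intro X
  ext i j
  rw [constantMap_apply, ← hT.2 X]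
  simp only [marginal₁, traceSnd, resetFst, traceFst, LinearMap.comp_apply, LinearMap.coe_mk,
    AddHom.coe_mk, Matrix.of_apply, Matrix.smul_apply, Matrix.single_apply, smul_eq_mul,
    Matrix.trace, Matrix.diag_apply, Fintype.sum_prod_type, mul_ite, mul_one, mul_zero,
    Finset.sum_ite_irrel, Finset.sum_const_zero, eq_comm (a := z)]
  congr 1
  exact Finset.sum_comm

/-- The Kraus operators of the asymmetric cloning channels. -/
noncomputable def clonerKraus (d : ℕ) (a b : ℝ) (k : Fin d) : Matrix (Fin d × Fin d) (Fin d) ℂ :=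
  Matrix.of fun p m => ((a / Real.sqrt d : ℝ) : ℂ) * (if p.1 = m then if p.2 = k then 1 else 0 else 0)
    + ((b / Real.sqrt d : ℝ) : ℂ) * (if p.2 = m then if p.1 = k then 1 else 0 else 0)

/-- The optimal asymmetric cloning channels. -/
noncomputable def cloner (d : ℕ) (a b : ℝ) : CloningMap d where
  toFun X := ∑ k, clonerKraus d a b k * X * (clonerKraus d a b k).conjTranspose
  map_add' X Y := by simp [Matrix.mul_add, Matrix.add_mul, Finset.sum_add_distrib]
  map_smul' c X := by simp [Finset.smul_sum]

lemma clonerKraus_mul_apply (a b : ℝ) (k : Fin d) (X : Matrix (Fin d) (Fin d) ℂ) (i j m : Fin d) :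
    (clonerKraus d a b k * X) (i, j) m =
      ((a / Real.sqrt d : ℝ) : ℂ) * (if j = k then X i m else 0)
        + ((b / Real.sqrt d : ℝ) : ℂ) * (if i = k then X j m else 0) := by
  simp [clonerKraus, Matrix.mul_apply, add_mul, Finset.sum_add_distrib]

lemma mul_conjTranspose_clonerKraus_apply (a b : ℝ) (k : Fin d)
    (Y : Matrix (Fin d × Fin d) (Fin d) ℂ) (p : Fin d × Fin d) (i j : Fin d) :
    (Y * (clonerKraus d a b k).conjTranspose) p (i, j) =
      ((a / Real.sqrt d : ℝ) : ℂ) * (if j = k then Y p i else 0)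
        + ((b / Real.sqrt d : ℝ) : ℂ) * (if i = k then Y p j else 0) := by
  simp only [clonerKraus, Matrix.mul_apply, Matrix.conjTranspose_apply, Matrix.of_apply, star_add,
    RCLike.star_def, Complex.conj_ofReal, apply_ite (starRingEnd ℂ), map_zero,
    mul_add, Finset.sum_add_distrib, mul_ite, mul_one, mul_zero, Finset.sum_ite_eq, Finset.mem_univ,
    if_true]
  congr 1 <;> split_ifs <;> ring

lemma cloner_apply (a b : ℝ) (X : Matrix (Fin d) (Fin d) ℂ) (i j i' j' : Fin d) :
    cloner d a b X (i, j) (i', j') = (1 / d : ℂ) *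
      (a ^ 2 * (if j = j' then X i i' else 0) + a * b * (if j = i' then X i j' else 0) +
        a * b * (if i = j' then X j i' else 0) + b ^ 2 * (if i = i' then X j j' else 0)) := by
  have hs : ((Real.sqrt d : ℝ) : ℂ) * (Real.sqrt d : ℝ) = d := by
    rw [← Complex.ofReal_mul, Real.mul_self_sqrt (Nat.cast_nonneg d), Complex.ofReal_natCast]
  rw [← hs]
  simp only [cloner, LinearMap.coe_mk, AddHom.coe_mk, Matrix.sum_apply,
    mul_conjTranspose_clonerKraus_apply, clonerKraus_mul_apply, Finset.sum_add_distrib,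
    mul_ite, mul_zero, Finset.sum_ite_eq, Finset.mem_univ, if_true]
  push_cast
  split_ifs <;> ring

/-- Each of the two interference terms contributes `(ab/d) X`, so the weight of `X` is `a² + 2ab/d`,
which the normalisation turns into `1 - b²`. -/
lemma marginal₁_cloner (a b : ℝ) (hab : a ^ 2 + b ^ 2 + 2 * a * b / d = 1)
    (X : Matrix (Fin d) (Fin d) ℂ) :
    marginal₁ (cloner d a b) X = (1 - b ^ 2 : ℝ) • X +
      (b ^ 2 / d : ℝ) • X.trace • (1 : Matrix (Fin d) (Fin d) ℂ) := by
  ext i i'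
  have hd0 : (d : ℂ) ≠ 0 := by
    have := i.pos
    exact_mod_cast this.ne'
  have e : (1 - b ^ 2 : ℝ) = a ^ 2 + 2 * a * b / d := by linarith
  rw [e]
  simp only [marginal₁, traceSnd, LinearMap.comp_apply, LinearMap.coe_mk, AddHom.coe_mk,
    Matrix.of_apply, cloner_apply, ← Finset.mul_sum, Finset.sum_add_distrib, if_true,
    Finset.sum_const, Finset.card_univ, Fintype.card_fin, Finset.sum_ite_eq, Finset.sum_ite_eq',
    Finset.mem_univ, Matrix.add_apply, Matrix.smul_apply, Matrix.one_apply, Finset.sum_ite_irrel,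
    Complex.real_smul, smul_eq_mul, nsmul_eq_mul, Matrix.trace,
    Matrix.diag_apply]
  push_cast
  split_ifs <;> field_simp <;> ring

lemma marginal₂_cloner (a b : ℝ) (hab : a ^ 2 + b ^ 2 + 2 * a * b / d = 1)
    (X : Matrix (Fin d) (Fin d) ℂ) :
    marginal₂ (cloner d a b) X = (1 - a ^ 2 : ℝ) • X +
      (a ^ 2 / d : ℝ) • X.trace • (1 : Matrix (Fin d) (Fin d) ℂ) := by
  rw [← marginal₁_cloner b a (by rw [← hab]; ring)]
  ext i i'
  simp only [marginal₁, marginal₂, traceSnd, traceFst, LinearMap.comp_apply, LinearMap.coe_mk,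
    AddHom.coe_mk, Matrix.of_apply, cloner_apply]
  exact Finset.sum_congr rfl fun _ _ => by ring

lemma isChannel_cloner {a b : ℝ} (hab : a ^ 2 + b ^ 2 + 2 * a * b / d = 1) :
    IsChannel (cloner d a b) := by
  refine ⟨isCompletelyPositive_of_kraus _ (clonerKraus d a b) fun X => rfl, fun X => ?_⟩
  have : (marginal₁ (cloner d a b) X).trace = (cloner d a b X).trace := isChannel_traceSnd.2 _
  rw [← this, marginal₁_cloner a b hab, Matrix.trace_add, Matrix.trace_smul, Matrix.trace_smul,
    Matrix.trace_smul, Matrix.trace_one, Fintype.card_fin, smul_eq_mul, Complex.real_smul,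
    Complex.real_smul]
  rcases Nat.eq_zero_or_pos d with rfl | hd
  · simp [Matrix.trace]
  · have hd0 : (d : ℂ) ≠ 0 := by exact_mod_cast hd.ne'
    push_cast
    field_simp
    ring

/-- The channel measuring in the standard basis and preparing `|π i, π i⟩` on outcome `i`. -/
noncomputable def measurePrepare (π : Fin d → Fin d) : CloningMap d where
  toFun X := ∑ k, Matrix.single (π k, π k) k (1 : ℂ) * X *
    (Matrix.single (π k, π k) k (1 : ℂ)).conjTranspose
  map_add' X Y := by simp [Matrix.mul_add, Matrix.add_mul, Finset.sum_add_distrib]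
  map_smul' c X := by simp [Finset.smul_sum]

lemma measurePrepare_apply (π : Fin d → Fin d) (X : Matrix (Fin d) (Fin d) ℂ) :
    measurePrepare π X = ∑ k, Matrix.single (π k, π k) (π k, π k) (X k k) := by
  simp only [measurePrepare, LinearMap.coe_mk, AddHom.coe_mk, Matrix.conjTranspose_single, star_one,
    Matrix.single_mul_mul_single, one_mul, mul_one]

lemma isChannel_measurePrepare (π : Fin d → Fin d) : IsChannel (measurePrepare π) := by
  refine ⟨isCompletelyPositive_of_kraus _ (fun k => Matrix.single (π k, π k) k 1) fun X => rfl,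
    fun X => ?_⟩
  rw [measurePrepare_apply, Matrix.trace_sum]
  simp [Matrix.trace]

lemma marginal₁_measurePrepare (π : Fin d → Fin d) (X : Matrix (Fin d) (Fin d) ℂ) :
    marginal₁ (measurePrepare π) X = ∑ k, Matrix.single (π k) (π k) (X k k) := by
  ext i j
  simp only [marginal₁, traceSnd, LinearMap.comp_apply, LinearMap.coe_mk,
    AddHom.coe_mk, Matrix.of_apply, measurePrepare_apply, Matrix.sum_apply, Matrix.single_apply,
    Prod.mk.injEq]
  rw [Finset.sum_comm]
  refine Finset.sum_congr rfl fun k _ => ?_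
  rw [Finset.sum_eq_single (π k)]
  · simp
  · intro l _ hl
    simp [hl.symm]
  · simp

lemma marginal₂_measurePrepare (π : Fin d → Fin d) (X : Matrix (Fin d) (Fin d) ℂ) :
    marginal₂ (measurePrepare π) X = ∑ k, Matrix.single (π k) (π k) (X k k) := by
  rw [← marginal₁_measurePrepare]
  ext i j
  simp only [marginal₁, marginal₂, traceSnd, traceFst, LinearMap.comp_apply, LinearMap.coe_mk,
    AddHom.coe_mk, Matrix.of_apply, measurePrepare_apply, Matrix.sum_apply, Matrix.single_apply,
    Prod.mk.injEq]
  refine Finset.sum_congr rfl fun _ _ => Finset.sum_congr rfl fun _ _ => ?_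
  congr 1
  simp only [and_comm]

end Cloning

/-! ### Entanglement fidelity -/

section Fidelity

variable {d : ℕ}

lemma star_omegaVec_mul (p q : Fin d × Fin d) : omegaVec d p * star (omegaVec d q) =
    if p.1 = p.2 then if q.1 = q.2 then (1 / d : ℂ) else 0 else 0 := by
  have hs : ((Real.sqrt d : ℝ) : ℂ) * (Real.sqrt d : ℝ) = d := by
    rw [← Complex.ofReal_mul, Real.mul_self_sqrt (Nat.cast_nonneg d), Complex.ofReal_natCast]
  rw [← hs]
  simp only [omegaVec]
  split_ifs <;> simp

lemma vecMulVec_omegaVec_apply (p q : Fin d × Fin d) :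
    Matrix.vecMulVec (omegaVec d) (star (omegaVec d)) p q =
    if p.1 = p.2 then if q.1 = q.2 then (1 / d : ℂ) else 0 else 0 :=
  star_omegaVec_mul p q

lemma star_omegaVec_dotProduct_mulVec (M : Matrix (Fin d × Fin d) (Fin d × Fin d) ℂ) :
    star (omegaVec d) ⬝ᵥ M.mulVec (omegaVec d) = (1 / d : ℂ) * ∑ i, ∑ j, M (i, i) (j, j) := by
  have : star (omegaVec d) ⬝ᵥ M.mulVec (omegaVec d) =
      ∑ p, ∑ q, M p q * (omegaVec d q * star (omegaVec d p)) := by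
    simp only [dotProduct, Matrix.mulVec, Finset.mul_sum, Pi.star_apply]
    exact Finset.sum_congr rfl fun _ _ => Finset.sum_congr rfl fun _ _ => by ring
  rw [this]
  simp only [star_omegaVec_mul, Fintype.sum_prod_type, mul_ite, mul_zero, Finset.sum_ite_eq,
    Finset.sum_ite_irrel, Finset.sum_const_zero, Finset.mem_univ, if_true, Finset.mul_sum]
  exact Finset.sum_congr rfl fun _ _ => Finset.sum_congr rfl fun _ _ => by ring

lemma omegaVec_block (i j : Fin d) :
    (Matrix.of fun a b => Matrix.vecMulVec (omegaVec d) (star (omegaVec d)) (i, a) (j, b)) =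
      (1 / d : ℂ) • Matrix.single i j (1 : ℂ) := by
  ext a b
  simp only [Matrix.of_apply, vecMulVec_omegaVec_apply, Matrix.smul_apply, Matrix.single_apply,
    smul_eq_mul, mul_ite, mul_one, mul_zero, ite_and]

lemma star_omegaVec_dotProduct_self (hd : d ≠ 0) : star (omegaVec d) ⬝ᵥ omegaVec d = 1 := by
  have h := star_omegaVec_dotProduct_mulVec (1 : Matrix (Fin d × Fin d) (Fin d × Fin d) ℂ)
  rw [Matrix.one_mulVec] at h
  have hd' : (d : ℂ) ≠ 0 := by exact_mod_cast hd
  rw [h]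
  simp [Matrix.one_apply, hd']

lemma omega_mem_densityMatrices (hd : d ≠ 0) :
    Matrix.vecMulVec (omegaVec d) (star (omegaVec d)) ∈ densityMatrices (Fin d × Fin d) :=
  ⟨Matrix.posSemidef_vecMulVec_self_star _, by
    rw [Matrix.trace_vecMulVec, dotProduct_comm, star_omegaVec_dotProduct_self hd]⟩

/-- One factor `1/d` comes from the Choi matrix and one from the overlap with `Ω`. -/
lemma quality_fidelity (L : Matrix (Fin d) (Fin d) ℂ →ₗ[ℂ] Matrix (Fin d) (Fin d) ℂ) :
    quality .fidelity L = 1 / (d : ℝ) ^ 2 * (∑ i, ∑ j, L (Matrix.single i j 1) i j).re := by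
  have : star (omegaVec d) ⬝ᵥ (choi L).mulVec (omegaVec d) =
      ((1 / (d : ℝ) ^ 2 : ℝ) : ℂ) * ∑ i, ∑ j, L (Matrix.single i j 1) i j := by
    rw [star_omegaVec_dotProduct_mulVec]
    simp only [choi, idTensor, Matrix.of_apply, omegaVec_block, map_smul, Matrix.smul_apply,
      smul_eq_mul, ← Finset.mul_sum]
    push_cast
    ring
  rw [quality, this, Complex.re_ofReal_mul]

lemma quality_fidelity_combination (s t : ℝ)
    (L M : Matrix (Fin d) (Fin d) ℂ →ₗ[ℂ] Matrix (Fin d) (Fin d) ℂ) :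
    quality .fidelity (s • L + t • M) = s * quality .fidelity L + t * quality .fidelity M := by
  simp only [quality_fidelity, LinearMap.add_apply, LinearMap.smul_apply, Matrix.add_apply,
    Matrix.smul_apply, Finset.sum_add_distrib, Complex.re_sum, Complex.add_re, Complex.smul_re,
    ← Finset.smul_sum, smul_eq_mul]
  ring

lemma quality_fidelity_depolarizing (hd : d ≠ 0) (q : ℝ)
    {L : Matrix (Fin d) (Fin d) ℂ →ₗ[ℂ] Matrix (Fin d) (Fin d) ℂ}
    (hL : ∀ X, L X = (1 - q : ℝ) • X + (q / d : ℝ) • X.trace • (1 : Matrix (Fin d) (Fin d) ℂ)) :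
    quality .fidelity L = 1 - q * (1 - 1 / (d : ℝ) ^ 2) := by
  have hd' : (d : ℝ) ≠ 0 := by exact_mod_cast hd
  have : ∑ i, ∑ j, L (Matrix.single i j 1) i j = (((1 - q) * d ^ 2 + q / d * d : ℝ) : ℂ) := by
    have h : ∀ i j : Fin d, L (Matrix.single i j 1) i j =
        ((1 - q : ℝ) : ℂ) + if i = j then ((q / d : ℝ) : ℂ) else 0 := fun i j => by
      rw [hL]
      by_cases hij : i = j
      · subst hij; simp
      · simp [hij, Matrix.trace_single_eq_of_ne]
    simp only [h, Finset.sum_add_distrib, Finset.sum_const, Finset.sum_ite_eq, Finset.mem_univ,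
      if_true, Finset.card_univ, Fintype.card_fin, nsmul_eq_mul]
    push_cast
    ring
  rw [quality_fidelity, this, Complex.ofReal_re]
  field_simp
  ring

open scoped InnerProductSpace in
/-- Bessel's inequality for the orthogonal planes spanned by pairs of unit vectors with
overlap `r`. -/
lemma sum_inner_planes_le {E ι : Type*} [NormedAddCommGroup E] [InnerProductSpace ℂ E] [Fintype ι]
    [DecidableEq ι] {u w : ι → E} {r : ℝ} (hr : r ^ 2 < 1)
    (hu : ∀ k l, ⟪u k, u l⟫_ℂ = if k = l then 1 else 0)
    (hw : ∀ k l, ⟪w k, w l⟫_ℂ = if k = l then 1 else 0)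
    (huw : ∀ k l, ⟪u k, w l⟫_ℂ = if k = l then (r : ℂ) else 0) (v : E) :
    ∑ k, (‖⟪u k, v⟫_ℂ‖ ^ 2 + ‖⟪w k, v⟫_ℂ‖ ^ 2 - 2 * r * (star ⟪u k, v⟫_ℂ * ⟪w k, v⟫_ℂ).re) ≤
      (1 - r ^ 2) * ‖v‖ ^ 2 := by
  have hwu : ∀ k l, ⟪w k, u l⟫_ℂ = if k = l then (r : ℂ) else 0 := fun k l => by
    rw [← inner_conj_symm, huw]
    by_cases h : k = l
    · simp [h]
    · simp [h, Ne.symm h]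
  set s : ℝ := (√(1 - r ^ 2))⁻¹
  have hpos : 0 < 1 - r ^ 2 := by linarith
  have hs : s * s = (1 - r ^ 2)⁻¹ := by
    rw [← mul_inv, Real.mul_self_sqrt hpos.le]
  have hsc : (s : ℂ) * (s : ℂ) * (1 - (r : ℂ) * r) = 1 := by
    rw [← Complex.ofReal_mul, hs]
    have : (1 - (r : ℂ) * r) = ((1 - r ^ 2 : ℝ) : ℂ) := by push_cast; ring
    rw [this, ← Complex.ofReal_mul, inv_mul_cancel₀ hpos.ne', Complex.ofReal_one]
  -- Gram–Schmidt inside each plane: `w k - r u k` is orthogonal to `u k` and has squared norm `1 -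
  -- r²`.
  have horth : Orthonormal ℂ
      (Sum.elim u fun k => (s : ℂ) • (w k - (r : ℂ) • u k)) := by
    rw [orthonormal_iff_ite]
    rintro (k | k) (l | l)
    · simp [hu]
    · simp only [Sum.elim_inl, Sum.elim_inr, inner_smul_right, inner_sub_right, hu, huw]
      split_ifs <;> simp_all
    · simp only [Sum.elim_inl, Sum.elim_inr, inner_smul_left, inner_sub_left, hu, hwu,
        Complex.conj_ofReal]
      split_ifs <;> simp_all
    · simp only [Sum.elim_inr, inner_smul_left, inner_smul_right, inner_sub_left, inner_sub_right,
        hu, huw, hw, hwu, Complex.conj_ofReal, Sum.inr.injEq]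
      split_ifs
      · linear_combination hsc
      · simp
  have h := horth.sum_inner_products_le (s := Finset.univ) v
  rw [Fintype.sum_sum_type] at h
  simp only [Sum.elim_inl, Sum.elim_inr, inner_smul_left, inner_sub_left, Complex.conj_ofReal,
    norm_mul, mul_pow] at h
  have hns : ‖(s : ℂ)‖ ^ 2 = (1 - r ^ 2)⁻¹ := by
    rw [Complex.norm_real, Real.norm_eq_abs, sq_abs, sq, hs]
  have hexp : ∀ a b : ℂ, ‖b - r * a‖ ^ 2 = ‖b‖ ^ 2 - 2 * r * (star a * b).re + r ^ 2 * ‖a‖ ^ 2 := by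
    intro a b
    simp only [Complex.sq_norm, Complex.normSq_apply, RCLike.star_def, Complex.mul_re,
      Complex.sub_re, Complex.sub_im, Complex.mul_im, Complex.conj_re, Complex.conj_im,
      Complex.ofReal_re, Complex.ofReal_im]
    ring
  rw [hns, ← Finset.sum_add_distrib] at h
  calc _ = (1 - r ^ 2) * ∑ k, (‖⟪u k, v⟫_ℂ‖ ^ 2 +
        (1 - r ^ 2)⁻¹ * ‖⟪w k, v⟫_ℂ - r * ⟪u k, v⟫_ℂ‖ ^ 2) := by
        rw [Finset.mul_sum]
        refine Finset.sum_congr rfl fun k _ => ?_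
        rw [mul_add, mul_inv_cancel_left₀ hpos.ne', hexp]
        ring
    _ ≤ _ := mul_le_mul_of_nonneg_left h hpos.le

-- This is `sum_inner_planes_le` on reference ⊗ clone ⊗ clone with overlap `r = 1/d`, multiplied by
-- `d`: the partial sums are, up to `√d`, the overlaps of `v` with `Ω` between the reference and one
-- clone and `e_k` on the other.
open scoped InnerProductSpace in
lemma sum_norm_sq_partial_le (hd : 2 ≤ d) (v : Fin d × Fin d × Fin d → ℂ) :
    ∑ k, (‖∑ i, v (i, i, k)‖ ^ 2 + ‖∑ i, v (i, k, i)‖ ^ 2 -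
      2 / (d : ℝ) * (star (∑ i, v (i, i, k)) * ∑ i, v (i, k, i)).re) ≤
      d * (1 - 1 / (d : ℝ) ^ 2) * ∑ p, ‖v p‖ ^ 2 := by
  have h2 : (2 : ℝ) ≤ d := by exact_mod_cast hd
  have hdp : (0 : ℝ) < d := by linarith
  set s : ℂ := (((√d : ℝ)⁻¹ : ℝ) : ℂ) with hs
  have hss : s * s = (d : ℂ)⁻¹ := by
    rw [hs, ← Complex.ofReal_mul, ← mul_inv, Real.mul_self_sqrt hdp.le]; simp
  have hcs : (starRingEnd ℂ) s = s := Complex.conj_ofReal _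
  have hns : ‖s‖ ^ 2 = (d : ℝ)⁻¹ := by
    rw [hs, Complex.norm_real, Real.norm_eq_abs, sq_abs, inv_pow, Real.sq_sqrt hdp.le]
  have hdc : (d : ℂ) ≠ 0 := by exact_mod_cast hdp.ne'
  set u : Fin d → EuclideanSpace ℂ (Fin d × Fin d × Fin d) := fun k =>
    WithLp.toLp 2 fun p => if p.2.1 = p.1 then if p.2.2 = k then s else 0 else 0
  set w : Fin d → EuclideanSpace ℂ (Fin d × Fin d × Fin d) := fun k =>
    WithLp.toLp 2 fun p => if p.2.2 = p.1 then if p.2.1 = k then s else 0 else 0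
  have hu : ∀ k l, ⟪u k, u l⟫_ℂ = if k = l then 1 else 0 := fun k l => by
    simp only [u, EuclideanSpace.inner_toLp_toLp, dotProduct, Pi.star_apply, Fintype.sum_prod_type,
      RCLike.star_def, apply_ite (starRingEnd ℂ), map_zero, hcs, mul_ite, mul_zero, ite_mul,
      zero_mul, Finset.sum_ite_irrel, Finset.sum_const_zero, Finset.sum_ite_eq', Finset.mem_univ, if_true, hss]
    split_ifs <;> simp_all
  have hw : ∀ k l, ⟪w k, w l⟫_ℂ = if k = l then 1 else 0 := fun k l => by
    simp only [w, EuclideanSpace.inner_toLp_toLp, dotProduct, Pi.star_apply, Fintype.sum_prod_type,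
      RCLike.star_def, apply_ite (starRingEnd ℂ), map_zero, hcs, mul_ite, mul_zero, ite_mul,
      zero_mul, Finset.sum_ite_eq', Finset.mem_univ, if_true, hss]
    split_ifs <;> simp_all
  have huw : ∀ k l, ⟪u k, w l⟫_ℂ = if k = l then (((d : ℝ)⁻¹ : ℝ) : ℂ) else 0 := fun k l => by
    simp only [u, w, EuclideanSpace.inner_toLp_toLp, dotProduct, Pi.star_apply,
      Fintype.sum_prod_type,
      RCLike.star_def, apply_ite (starRingEnd ℂ), map_zero, hcs, mul_ite, mul_zero, ite_mul,
      zero_mul, Finset.sum_ite_irrel, Finset.sum_const_zero, Finset.sum_ite_eq', Finset.sum_ite_eq,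
      Finset.mem_univ, if_true, hss]
    split_ifs <;> simp_all
  have hr : ((d : ℝ)⁻¹) ^ 2 < 1 := by
    have := one_sub_inv_sq_pos hd
    rw [inv_pow, ← one_div]; linarith
  have huv : ∀ k, ⟪u k, WithLp.toLp 2 v⟫_ℂ = s * ∑ i, v (i, i, k) := fun k => by
    simp only [u, EuclideanSpace.inner_toLp_toLp, dotProduct, Pi.star_apply, Fintype.sum_prod_type,
      RCLike.star_def, apply_ite (starRingEnd ℂ), map_zero, hcs, mul_ite, mul_zero,
      Finset.sum_ite_irrel, Finset.sum_const_zero, Finset.sum_ite_eq', Finset.mem_univ, if_true, Finset.mul_sum, mul_comm]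
  have hwv : ∀ k, ⟪w k, WithLp.toLp 2 v⟫_ℂ = s * ∑ i, v (i, k, i) := fun k => by
    simp only [w, EuclideanSpace.inner_toLp_toLp, dotProduct, Pi.star_apply, Fintype.sum_prod_type,
      RCLike.star_def, apply_ite (starRingEnd ℂ), map_zero, hcs, mul_ite, mul_zero,
      Finset.sum_ite_eq', Finset.mem_univ, if_true, Finset.mul_sum, mul_comm]
  have h := sum_inner_planes_le hr hu hw huw (WithLp.toLp 2 v)
  rw [EuclideanSpace.norm_sq_eq] at h
  simp only [huv, hwv, norm_mul, mul_pow, hns] at h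
  have hre : ∀ a b : ℂ, (star (s * a) * (s * b)).re = (d : ℝ)⁻¹ * (star a * b).re := fun a b => by
    rw [star_mul', RCLike.star_def, hcs, mul_mul_mul_comm, hss,
      show ((d : ℂ)⁻¹) = (((d : ℝ)⁻¹ : ℝ) : ℂ) by push_cast; rfl, Complex.re_ofReal_mul]
  simp only [hre] at h
  have h' := mul_le_mul_of_nonneg_left h hdp.le
  rw [Finset.mul_sum] at h'
  refine le_trans (le_of_eq (Finset.sum_congr rfl fun k _ => ?_)) (h'.trans (le_of_eq ?_))
  · field_simp
  · rw [inv_pow, one_div]; ring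

lemma sum_mul_star_eq {ι κ : Type*} [Fintype ι] [Fintype κ] (a : κ → ι → ℂ) :
    ∑ i, ∑ j, ∑ p, a p i * star (a p j) = ((∑ p, ‖∑ i, a p i‖ ^ 2 : ℝ) : ℂ) := by
  push_cast
  simp only [← Complex.mul_conj', map_sum, Finset.sum_mul_sum]
  simp only [Finset.sum_comm (s := (Finset.univ : Finset κ))]
  rfl

/-- The entanglement fidelities of the marginals of a cloning channel are compatible. -/
lemma qualities_fidelity_mem (hd : 2 ≤ d) {T : CloningMap d} (hT : IsChannel T) :
    qualities .fidelity T ∈ fidelitySet d := by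
  have h2 : (2 : ℝ) ≤ d := by exact_mod_cast hd
  have hdp : (0 : ℝ) < d := by linarith
  obtain ⟨hC, htr⟩ := hT.idTensor_mem_densityMatrices (omega_mem_densityMatrices (d := d) (by omega))
  -- Decompose the Choi state of `T` into rank-one terms; both fidelities become sums of squared
  -- overlaps of the same vectors.
  obtain ⟨N, v, hv⟩ := Matrix.posSemidef_iff_eq_sum_vecMulVec.1 hC
  have hq1 : quality .fidelity (marginal₁ T) =
      (d : ℝ)⁻¹ * ∑ p : Fin N × Fin d, ‖∑ i, v p.1 (i, i, p.2)‖ ^ 2 := by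
    have hc : ∀ i j, choi (marginal₁ T) (i, i) (j, j) =
        ∑ p : Fin N × Fin d, v p.1 (i, i, p.2) * star (v p.1 (j, j, p.2)) := fun i j => by
      rw [Fintype.sum_prod_type, Finset.sum_comm]
      change ∑ k, idTensor (Fin d) T (Matrix.vecMulVec (omegaVec d) (star (omegaVec d)))
        (i, i, k) (j, j, k) = _
      simp only [hv, Matrix.sum_apply, Matrix.vecMulVec_apply, Pi.star_apply]
    rw [quality, star_omegaVec_dotProduct_mulVec]
    simp only [hc]
    rw [sum_mul_star_eq fun (p : Fin N × Fin d) i => v p.1 (i, i, p.2), one_div,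
      ← Complex.ofReal_natCast, ← Complex.ofReal_inv, ← Complex.ofReal_mul, Complex.ofReal_re]
  have hq2 : quality .fidelity (marginal₂ T) =
      (d : ℝ)⁻¹ * ∑ p : Fin N × Fin d, ‖∑ i, v p.1 (i, p.2, i)‖ ^ 2 := by
    have hc : ∀ i j, choi (marginal₂ T) (i, i) (j, j) =
        ∑ p : Fin N × Fin d, v p.1 (i, p.2, i) * star (v p.1 (j, p.2, j)) := fun i j => by
      rw [Fintype.sum_prod_type, Finset.sum_comm]
      change ∑ k, idTensor (Fin d) T (Matrix.vecMulVec (omegaVec d) (star (omegaVec d)))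
        (i, k, i) (j, k, j) = _
      simp only [hv, Matrix.sum_apply, Matrix.vecMulVec_apply, Pi.star_apply]
    rw [quality, star_omegaVec_dotProduct_mulVec]
    simp only [hc]
    rw [sum_mul_star_eq fun (p : Fin N × Fin d) i => v p.1 (i, p.2, i), one_div,
      ← Complex.ofReal_natCast, ← Complex.ofReal_inv, ← Complex.ofReal_mul, Complex.ofReal_re]
  have htr' : ∑ r, ∑ p, ‖v r p‖ ^ 2 = 1 := by
    rw [hv, Matrix.trace_sum] at htr
    simp only [Matrix.trace_vecMulVec, dotProduct, Pi.star_apply, RCLike.star_def,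
      Complex.mul_conj'] at htr
    exact_mod_cast htr
  have hsum := Finset.sum_le_sum fun r (_ : r ∈ Finset.univ) => sum_norm_sq_partial_le hd (v r)
  rw [← Finset.mul_sum, htr', mul_one, ← Fintype.sum_prod_type'] at hsum
  simp only [Finset.sum_sub_distrib, Finset.sum_add_distrib, ← Finset.mul_sum] at hsum
  -- Cauchy–Schwarz over all terms and all `k` at once turns the cross term into the product of the
  -- square roots of the fidelities.
  have hcs : ∑ p : Fin N × Fin d, (star (∑ i, v p.1 (i, i, p.2)) * ∑ i, v p.1 (i, p.2, i)).re ≤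
      √(∑ p : Fin N × Fin d, ‖∑ i, v p.1 (i, i, p.2)‖ ^ 2) *
      √(∑ p : Fin N × Fin d, ‖∑ i, v p.1 (i, p.2, i)‖ ^ 2) := by
    refine le_trans (Finset.sum_le_sum fun p _ => ?_) (Real.sum_mul_le_sqrt_mul_sqrt _ _ _)
    refine (Complex.re_le_norm _).trans ?_
    rw [norm_mul, norm_star]
  refine ⟨?_, ?_, ?_⟩
  · rw [qualities, hq1]; positivity
  · rw [qualities, hq2]; positivity
  · simp only [qualities, hq1, hq2]
    rw [Real.sqrt_mul (by positivity), Real.sqrt_mul (by positivity), mul_mul_mul_comm,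
      Real.mul_self_sqrt (by positivity)]
    set A := ∑ p : Fin N × Fin d, ‖∑ i, v p.1 (i, i, p.2)‖ ^ 2
    set B := ∑ p : Fin N × Fin d, ‖∑ i, v p.1 (i, p.2, i)‖ ^ 2
    have h1 := mul_le_mul_of_nonneg_left hcs (show 0 ≤ 2 / (d : ℝ) by positivity)
    have h3 : A + B - 2 / (d : ℝ) * (√A * √B) ≤ d * (1 - 1 / (d : ℝ) ^ 2) := by linarith
    have h4 := mul_le_mul_of_nonneg_left h3 (inv_nonneg.2 hdp.le)
    rw [inv_mul_cancel_left₀ hdp.ne'] at h4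
    refine le_trans (le_of_eq ?_) h4
    ring

/-! ### A lower bound for the worst pure-state fidelity -/

lemma star_single_one {m : Type} [DecidableEq m] (a : m) :
    star (Pi.single a 1 : m → ℂ) = (Pi.single a 1 : m → ℂ) := by
  ext i
  by_cases h : i = a
  · subst h; simp
  · simp [h]

/-- The fidelity form `⟨x| L(|x⟩⟨x|) |x⟩`. -/
noncomputable def pureFidelity (L : Matrix (Fin d) (Fin d) ℂ →ₗ[ℂ] Matrix (Fin d) (Fin d) ℂ)
    (x : Fin d → ℂ) : ℂ :=
  star x ⬝ᵥ (L (Matrix.vecMulVec x (star x))).mulVec x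

lemma pureFidelity_eq_sum (L : Matrix (Fin d) (Fin d) ℂ →ₗ[ℂ] Matrix (Fin d) (Fin d) ℂ)
    (x : Fin d → ℂ) : pureFidelity L x =
      ∑ i, ∑ j, ∑ k, ∑ l, L (Matrix.single i j 1) k l * (x i * star (x j) * star (x k) * x l) := by
  have h : Matrix.vecMulVec x (star x) =
      ∑ i, ∑ j, (x i * star (x j)) • Matrix.single i j (1 : ℂ) := by
    conv_lhs => rw [Matrix.matrix_eq_sum_single (Matrix.vecMulVec x (star x))]
    simp only [Matrix.smul_single, smul_eq_mul, mul_one, Matrix.vecMulVec_apply, Pi.star_apply]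
  rw [pureFidelity, h]
  simp only [map_sum, map_smul, dotProduct, Matrix.mulVec, Matrix.sum_apply, Matrix.smul_apply,
    Finset.sum_mul, Finset.mul_sum, Pi.star_apply, smul_eq_mul]
  rw [Finset.sum_congr rfl fun k _ => Finset.sum_comm]
  rw [Finset.sum_comm]
  refine Finset.sum_congr rfl fun i _ => ?_
  rw [Finset.sum_congr rfl fun k _ => Finset.sum_comm]
  rw [Finset.sum_comm]
  refine Finset.sum_congr rfl fun j _ => Finset.sum_congr rfl fun k _ =>
    Finset.sum_congr rfl fun l _ => ?_
  ring

/-- The vector of phases attached to a vector of residues modulo three. -/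
noncomputable def phaseVec (ω : Fin d → ZMod 3) : Fin d → ℂ := fun i => ZMod.stdAddChar (ω i)

/-- Character orthogonality: the sum survives only if `ω i - ω j - ω k + ω l` vanishes identically.
Cube roots of unity are used because with signs alone the pairing `i = l`, `j = k` would survive
too. -/
lemma sum_phaseVec (i j k l : Fin d) :
    ∑ ω : Fin d → ZMod 3, phaseVec ω i * star (phaseVec ω j) * star (phaseVec ω k) * phaseVec ω l =
      (3 : ℂ) ^ d * if (i = j ∧ k = l) ∨ (i = k ∧ j = l) then 1 else 0 := by
  set φ : (Fin d → ZMod 3) →+ ZMod 3 :=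
    Pi.evalAddMonoidHom (fun _ => ZMod 3) i - Pi.evalAddMonoidHom (fun _ => ZMod 3) j -
      Pi.evalAddMonoidHom (fun _ => ZMod 3) k + Pi.evalAddMonoidHom (fun _ => ZMod 3) l
  have hφ : ∀ ω, φ ω = ω i - ω j - ω k + ω l := fun ω => rfl
  set ψ : AddChar (Fin d → ZMod 3) ℂ := (ZMod.stdAddChar (N := 3)).compAddMonoidHom φ
  have hψ : ∀ ω : Fin d → ZMod 3, phaseVec ω i * star (phaseVec ω j) * star (phaseVec ω k) *
      phaseVec ω l = ψ ω := fun ω => by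
    simp only [phaseVec, RCLike.star_def, ← AddChar.map_neg_eq_conj, ← AddChar.map_add_eq_mul]
    rw [AddChar.compAddMonoidHom_apply, hφ]
    congr 1
    ring
  simp only [hψ]
  rw [AddChar.sum_eq_ite]
  have key : ψ = 0 ↔ (i = j ∧ k = l) ∨ (i = k ∧ j = l) := by
    constructor
    · intro h0
      have hz : ∀ ω : Fin d → ZMod 3, ω i - ω j - ω k + ω l = 0 := fun ω => by
        have : ψ ω = 1 := by rw [h0]; rfl
        rw [AddChar.compAddMonoidHom_apply, hφ] at this
        exact ZMod.injective_stdAddChar (this.trans (AddChar.map_zero_eq_one _).symm)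
      by_contra! hne
      by_cases hij : i = j
      · have h := hz (Pi.single l 1)
        have hkl := hne.1 hij
        subst hij
        simp [hkl] at h
      · by_cases hik : i = k
        · have h := hz (Pi.single l 1)
          have hjl := hne.2 hik
          subst hik
          simp [hjl] at h
        -- The coefficient of `ω i` is now `1` or `2`, both nonzero modulo three.
        · have h := hz (Pi.single i 1)
          simp only [Pi.single_eq_same, Pi.single_apply, Ne.symm hij, Ne.symm hik, if_false] at h
          split_ifs at h <;> revert h <;> decide
    · intro h
      ext ω
      have : φ ω = 0 := by
        rw [hφ]
        rcases h with ⟨rfl, rfl⟩ | ⟨rfl, rfl⟩ <;> ring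
      rw [AddChar.compAddMonoidHom_apply, this, AddChar.map_zero_eq_one]
      rfl
  simp only [key]
  split_ifs <;> simp

/-- The basis vectors together with the phase vectors form a weighted complex two-design. -/
lemma sum_pureFidelity (L : Matrix (Fin d) (Fin d) ℂ →ₗ[ℂ] Matrix (Fin d) (Fin d) ℂ) :
    3 ^ d * ∑ i, pureFidelity L (Pi.single i 1) + ∑ ω, pureFidelity L (phaseVec ω) =
      3 ^ d * ((L 1).trace + ∑ i, ∑ j, L (Matrix.single i j 1) i j) := by
  have h1 : ∑ ω, pureFidelity L (phaseVec ω) = ∑ i, ∑ j, ∑ k, ∑ l, L (Matrix.single i j 1) k l *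
      ((3 : ℂ) ^ d * if (i = j ∧ k = l) ∨ (i = k ∧ j = l) then 1 else 0) := by
    simp only [pureFidelity_eq_sum, ← sum_phaseVec, Finset.mul_sum]
    simp only [Finset.sum_comm (s := (Finset.univ : Finset (Fin d → ZMod 3)))]
  have h2 : ∀ a : Fin d, pureFidelity L (Pi.single a 1) = L (Matrix.single a a 1) a a := fun a => by
    rw [pureFidelity, star_single_one, ← Matrix.single_eq_single_vecMulVec_single]
    simp
  -- Inclusion–exclusion: the subtracted all-equal term is exactly what the basis vectors put back.
  have h3 : ∀ i j k l : Fin d, (if (i = j ∧ k = l) ∨ (i = k ∧ j = l) then (1 : ℂ) else 0) =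
      (if i = j then if k = l then 1 else 0 else 0) + (if i = k then if j = l then 1 else 0 else 0)
        - (if i = j then if i = k then if k = l then 1 else 0 else 0 else 0) := fun i j k l => by
    by_cases hij : i = j <;> by_cases hik : i = k <;> by_cases hkl : k = l <;> simp_all
  have h4 : (L 1).trace = ∑ i, ∑ k, L (Matrix.single i i 1) k k := by
    rw [← Matrix.sum_single_one, map_sum, Matrix.trace_sum]
    rfl
  simp only [h1, h2, h3, h4, mul_left_comm _ ((3 : ℂ) ^ d), ← Finset.mul_sum, ← mul_add]
  congr 1
  simp only [mul_sub, mul_add, Finset.sum_sub_distrib, Finset.sum_add_distrib, mul_ite, mul_one,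
    mul_zero, Finset.sum_ite_irrel, Finset.sum_const_zero, Finset.sum_ite_eq, Finset.mem_univ,
    if_true]
  ring

lemma star_phaseVec_dotProduct_self (ω : Fin d → ZMod 3) :
    star (phaseVec ω) ⬝ᵥ phaseVec ω = d := by
  simp only [dotProduct, Pi.star_apply, phaseVec, RCLike.star_def, ← AddChar.map_neg_eq_conj,
    ← AddChar.map_add_eq_mul, neg_add_cancel, AddChar.map_zero_eq_one]
  simp

lemma pureFidelity_smul (L : Matrix (Fin d) (Fin d) ℂ →ₗ[ℂ] Matrix (Fin d) (Fin d) ℂ) (r : ℝ)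
    (x : Fin d → ℂ) : pureFidelity L ((r : ℂ) • x) = ((r ^ 4 : ℝ) : ℂ) * pureFidelity L x := by
  simp only [pureFidelity, star_smul, Matrix.vecMulVec_smul, Matrix.smul_vecMulVec, map_smul,
    Matrix.smul_mulVec, Matrix.mulVec_smul, dotProduct_smul, smul_dotProduct, smul_eq_mul,
    RCLike.star_def, Complex.conj_ofReal]
  push_cast
  ring

/-- Some pure state is transmitted with at most the average fidelity. -/
lemma exists_pureFidelity_le (hd : d ≠ 0)
    {L : Matrix (Fin d) (Fin d) ℂ →ₗ[ℂ] Matrix (Fin d) (Fin d) ℂ}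
    (hL : ∀ X, (L X).trace = X.trace) :
    ∃ x : Fin d → ℂ, star x ⬝ᵥ x = 1 ∧
      (pureFidelity L x).re * (d + 1) ≤ d * quality .fidelity L + 1 := by
  by_contra! hcon
  have hdp : (0 : ℝ) < d := by exact_mod_cast Nat.pos_of_ne_zero hd
  -- `m` is the average over the design. If every unit vector exceeded it, the design identity would
  -- fail; phase vectors have squared norm `d`, hence the factor `d ^ 2` below.
  set m := (d * quality .fidelity L + 1) / ((d : ℝ) + 1) with hm
  have h1 : ∀ i : Fin d, m < (pureFidelity L (Pi.single i 1)).re := fun i => by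
    rw [hm, div_lt_iff₀ (by positivity)]
    exact hcon _ (by rw [star_single_one]; simp)
  have h2 : ∀ ω : Fin d → ZMod 3, (d : ℝ) ^ 2 * m < (pureFidelity L (phaseVec ω)).re := fun ω => by
    have hs : √(d : ℝ) ^ 2 = d := Real.sq_sqrt hdp.le
    have h := hcon ((((√(d : ℝ))⁻¹ : ℝ) : ℂ) • phaseVec ω) (by
      rw [star_smul, smul_dotProduct, dotProduct_smul, star_phaseVec_dotProduct_self, smul_eq_mul,
        smul_eq_mul, RCLike.star_def, Complex.conj_ofReal, ← Complex.ofReal_natCast,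
        ← Complex.ofReal_mul, ← Complex.ofReal_mul, ← mul_assoc, ← sq, inv_pow, hs,
        inv_mul_cancel₀ hdp.ne', Complex.ofReal_one])
    rw [pureFidelity_smul, Complex.re_ofReal_mul, inv_pow,
      show √(d : ℝ) ^ 4 = (√(d : ℝ) ^ 2) ^ 2 by ring, hs, ← div_lt_iff₀ (by positivity), ← hm,
      lt_inv_mul_iff₀ (by positivity)] at h
    exact h
  have hsum := congrArg Complex.re (sum_pureFidelity L)
  rw [hL 1, Matrix.trace_one, Fintype.card_fin] at hsum
  have h3 : ((3 : ℂ) ^ d) = ((3 ^ d : ℝ) : ℂ) := by push_cast; rfl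
  rw [h3, Complex.add_re, Complex.re_ofReal_mul, Complex.re_ofReal_mul, Complex.re_sum,
    Complex.re_sum, Complex.add_re, Complex.natCast_re] at hsum
  have hF : (∑ i, ∑ j, L (Matrix.single i j 1) i j).re = d ^ 2 * quality .fidelity L := by
    rw [quality_fidelity]; field_simp
  have : NeZero d := ⟨hd⟩
  have e1 : (d : ℝ) * m ≤ ∑ i, (pureFidelity L (Pi.single i 1)).re := by
    have := Finset.sum_le_sum fun (i : Fin d) (_ : i ∈ Finset.univ) => (h1 i).le
    simpa using this
  have e2 : (3 : ℝ) ^ d * ((d : ℝ) ^ 2 * m) < ∑ ω, (pureFidelity L (phaseVec ω)).re := by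
    have := Finset.sum_lt_sum_of_nonempty (s := Finset.univ) Finset.univ_nonempty
      fun (ω : Fin d → ZMod 3) _ => h2 ω
    simpa using this
  rw [hF] at hsum
  have e3 : (d : ℝ) + d ^ 2 * quality .fidelity L = d * m + d ^ 2 * m := by
    rw [hm]; field_simp; ring
  rw [e3] at hsum
  have e4 := mul_le_mul_of_nonneg_left e1 (show (0 : ℝ) ≤ 3 ^ d by positivity)
  linarith

end Fidelity

/-! ### Norm distances between states -/

section States

variable {m : Type} [Fintype m]

lemma vecMulVec_mem_densityMatrices {x : m → ℂ} (hx : star x ⬝ᵥ x = 1) :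
    Matrix.vecMulVec x (star x) ∈ densityMatrices m :=
  ⟨Matrix.posSemidef_vecMulVec_self_star _, by rw [Matrix.trace_vecMulVec, dotProduct_comm, hx]⟩

lemma star_dotProduct_vecMulVec_mulVec {x : m → ℂ} (hx : star x ⬝ᵥ x = 1) :
    star x ⬝ᵥ (Matrix.vecMulVec x (star x)).mulVec x = 1 := by
  rw [Matrix.vecMulVec_mulVec, hx]
  simpa using hx

lemma frobeniusNorm_sq (X : Matrix m m ℂ) :
    frobeniusNorm X ^ 2 = (X.conjTranspose * X).trace.re := by
  rw [frobeniusNorm, Real.sq_sqrt (by positivity), Finset.sum_comm]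
  simp only [Matrix.trace, Matrix.diag_apply, Matrix.mul_apply, Matrix.conjTranspose_apply,
    RCLike.star_def, Complex.conj_mul', Complex.re_sum]
  norm_cast

lemma re_trace_conjTranspose_mul_le (A B : Matrix m m ℂ) :
    (A.conjTranspose * B).trace.re ≤ frobeniusNorm A * frobeniusNorm B := by
  have e : (A.conjTranspose * B).trace = inner ℂ
      (WithLp.toLp 2 (fun p : m × m => A p.1 p.2)) (WithLp.toLp 2 (fun p : m × m => B p.1 p.2)) := by
    simp only [Matrix.trace, Matrix.diag_apply, Matrix.mul_apply, Matrix.conjTranspose_apply,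
      EuclideanSpace.inner_toLp_toLp, dotProduct, Pi.star_apply, Fintype.sum_prod_type]
    rw [Finset.sum_comm]
    exact Finset.sum_congr rfl fun _ _ => Finset.sum_congr rfl fun _ _ => mul_comm _ _
  rw [e, frobeniusNorm_eq_norm, frobeniusNorm_eq_norm]
  exact (Complex.re_le_norm _).trans (norm_inner_le_norm _ _)

lemma frobeniusNorm_nonneg (X : Matrix m m ℂ) : 0 ≤ frobeniusNorm X := Real.sqrt_nonneg _

variable [DecidableEq m]

-- Write `ρ` as a sum of `v v*` with squared norms adding up to one and apply Cauchy–Schwarz to each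
-- term of `⟨x, ρ x⟩`.
open scoped InnerProductSpace in
lemma one_sub_posSemidef {ρ : Matrix m m ℂ} (hρ : ρ ∈ densityMatrices m) :
    (1 - ρ).PosSemidef := by
  refine Matrix.PosSemidef.of_dotProduct_mulVec_nonneg (Matrix.isHermitian_one.sub hρ.1.1) fun x => ?_
  obtain ⟨N, v, rfl⟩ := Matrix.posSemidef_iff_eq_sum_vecMulVec.1 hρ.1
  have htr : ∑ r, ‖WithLp.toLp 2 (v r)‖ ^ 2 = 1 := by
    have h := hρ.2
    simp only [Matrix.trace_sum, Matrix.trace_vecMulVec, dotProduct_comm _ (star (v _)),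
      ← inner_self_toLp] at h
    exact_mod_cast h
  have hterm : ∀ r, star x ⬝ᵥ (Matrix.vecMulVec (v r) (star (v r))).mulVec x =
      ((‖⟪WithLp.toLp 2 (v r), WithLp.toLp 2 x⟫_ℂ‖ ^ 2 : ℝ) : ℂ) := fun r => by
    rw [Matrix.vecMulVec_mulVec, EuclideanSpace.inner_toLp_toLp, dotProduct_comm x]
    push_cast
    rw [← Complex.conj_mul']
    simp only [dotProduct_smul, MulOpposite.smul_eq_mul_unop, MulOpposite.unop_op]
    congr 1
    rw [← RCLike.star_def, Matrix.star_dotProduct]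
  rw [Matrix.sub_mulVec, Matrix.one_mulVec, dotProduct_sub, ← inner_self_toLp, Matrix.sum_mulVec,
    dotProduct_sum]
  simp only [hterm]
  rw [← Complex.ofReal_sum, ← Complex.ofReal_sub, Complex.zero_le_real, sub_nonneg]
  calc _ ≤ ∑ r, ‖WithLp.toLp 2 (v r)‖ ^ 2 * ‖WithLp.toLp 2 x‖ ^ 2 :=
        Finset.sum_le_sum fun r _ => by
          rw [← mul_pow]
          exact pow_le_pow_left₀ (norm_nonneg _) (norm_inner_le_norm _ _) 2
    _ = _ := by rw [← Finset.sum_mul, htr, one_mul]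

lemma traceNorm_sub_le_two {ρ σ : Matrix m m ℂ} (hρ : ρ ∈ densityMatrices m)
    (hσ : σ ∈ densityMatrices m) : traceNorm (ρ - σ) ≤ 2 := by
  have := traceNorm_sub_le hρ.1 hσ.1
  rw [hρ.2, hσ.2] at this
  norm_num at this
  exact this

lemma operatorNorm_sub_le_one {ρ σ : Matrix m m ℂ} (hρ : ρ ∈ densityMatrices m)
    (hσ : σ ∈ densityMatrices m) : operatorNorm (ρ - σ) ≤ 1 := by
  refine operatorNorm_le (hρ.1.1.sub hσ.1.1) zero_le_one ?_ ?_
  · have := (one_sub_posSemidef hρ).add hσ.1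
    convert this using 1
    simp; abel
  · have := (one_sub_posSemidef hσ).add hρ.1
    convert this using 1
    simp; abel

lemma operatorNorm_le_one {ρ : Matrix m m ℂ} (hρ : ρ ∈ densityMatrices m) :
    operatorNorm ρ ≤ 1 := by
  refine operatorNorm_le hρ.1.1 zero_le_one ?_ ?_
  · simpa using one_sub_posSemidef hρ
  · simpa using Matrix.PosSemidef.one.add hρ.1

lemma re_trace_mul_self_le_one {ρ : Matrix m m ℂ} (hρ : ρ ∈ densityMatrices m) :
    (ρ * ρ).trace.re ≤ 1 := by
  have := re_trace_mul_le_of_posSemidef (operatorNorm_le_one hρ) hρ.1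
  rwa [hρ.2] at this

lemma frobeniusNorm_le_one {ρ : Matrix m m ℂ} (hρ : ρ ∈ densityMatrices m) :
    frobeniusNorm ρ ≤ 1 := by
  rw [← sq_le_sq₀ (frobeniusNorm_nonneg _) zero_le_one, frobeniusNorm_sq, hρ.1.1.eq, one_pow]
  exact re_trace_mul_self_le_one hρ

/-- The constant is not sharp; it only serves to bound the suprema. -/
lemma frobeniusNorm_sub_le_two {ρ σ : Matrix m m ℂ} (hρ : ρ ∈ densityMatrices m)
    (hσ : σ ∈ densityMatrices m) : frobeniusNorm (ρ - σ) ≤ 2 := by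
  have := map_sub_le_add (frobeniusSeminorm m) ρ σ
  refine this.trans ?_
  have := add_le_add (frobeniusNorm_le_one hρ) (frobeniusNorm_le_one hσ)
  norm_num at this
  exact this

end States

/-! ### Distances to the maximally mixed state -/

section MixedDistance

variable {d : ℕ}

lemma inv_smul_one_sub_traceNorm_le (hd : d ≠ 0) {ρ : Matrix (Fin d) (Fin d) ℂ}
    (hρ : ρ ∈ densityMatrices (Fin d)) :
    traceNorm ((1 / d : ℝ) • (1 : Matrix (Fin d) (Fin d) ℂ) - ρ) ≤ 2 * (1 - 1 / (d : ℝ)) := by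
  have hd' : (0 : ℝ) < d := by exact_mod_cast Nat.pos_of_ne_zero hd
  have hle : 1 / (d : ℝ) ≤ 1 := by
    rw [div_le_one hd']; exact_mod_cast Nat.pos_of_ne_zero hd
  -- A difference of two positive matrices, each of trace `1 - 1/d`.
  have e : (1 / d : ℝ) • (1 : Matrix (Fin d) (Fin d) ℂ) - ρ =
      (1 / d : ℝ) • (1 - ρ) - (1 - 1 / (d : ℝ)) • ρ := by
    rw [smul_sub, sub_smul, one_smul]; abel
  rw [e]
  refine (traceNorm_sub_le ((one_sub_posSemidef hρ).smul (by positivity))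
    (hρ.1.smul (sub_nonneg.2 hle))).trans (le_of_eq ?_)
  rw [Matrix.trace_smul, Matrix.trace_smul, Matrix.trace_sub, hρ.2, Matrix.trace_one,
    Fintype.card_fin, Complex.smul_re, Complex.smul_re]
  simp
  field_simp
  ring

lemma inv_smul_one_sub_operatorNorm_le (hd : 2 ≤ d) {ρ : Matrix (Fin d) (Fin d) ℂ}
    (hρ : ρ ∈ densityMatrices (Fin d)) :
    operatorNorm ((1 / d : ℝ) • (1 : Matrix (Fin d) (Fin d) ℂ) - ρ) ≤ 1 - 1 / (d : ℝ) := by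
  have h2 : (2 : ℝ) ≤ d := by exact_mod_cast hd
  have hle : 2 * (1 / (d : ℝ)) ≤ 1 := by
    rw [← mul_div_assoc, div_le_one (by linarith)]; linarith
  have h0 : 0 ≤ 1 / (d : ℝ) := by positivity
  refine operatorNorm_le ((Matrix.isHermitian_one.smul (IsSelfAdjoint.all _)).sub hρ.1.1)
    (by linarith) ?_ ?_
  -- This side equals `(1 - 2/d) 1 + ρ`, which is where `d ≥ 2` enters; the other side is `1 - ρ`.
  · have := (Matrix.PosSemidef.one (n := Fin d) (R := ℂ)).smul
      (show 0 ≤ 1 - 2 * (1 / (d : ℝ)) by linarith) |>.add hρ.1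
    convert this using 1
    rw [Complex.coe_smul, sub_smul, sub_smul, one_smul, two_mul, add_smul]
    abel
  · have := one_sub_posSemidef hρ
    convert this using 1
    rw [Complex.coe_smul, sub_smul, one_smul]
    abel

lemma inv_smul_one_sub_frobeniusNorm_le (hd : d ≠ 0) {ρ : Matrix (Fin d) (Fin d) ℂ}
    (hρ : ρ ∈ densityMatrices (Fin d)) :
    frobeniusNorm ((1 / d : ℝ) • (1 : Matrix (Fin d) (Fin d) ℂ) - ρ) ≤ √(1 - 1 / (d : ℝ)) := by
  have hd' : (d : ℝ) ≠ 0 := by exact_mod_cast hd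
  apply Real.le_sqrt_of_sq_le
  rw [frobeniusNorm_sq]
  have hh : ((1 / d : ℝ) • (1 : Matrix (Fin d) (Fin d) ℂ) - ρ).IsHermitian :=
    (Matrix.isHermitian_one.smul (IsSelfAdjoint.all _)).sub hρ.1.1
  rw [hh.eq, sub_mul, mul_sub, mul_sub, Matrix.smul_mul, Matrix.smul_mul, Matrix.mul_smul,
    Matrix.one_mul, Matrix.one_mul, Matrix.mul_smul, Matrix.mul_one]
  simp only [Matrix.trace_sub, Matrix.trace_smul, hρ.2, Matrix.trace_one, Fintype.card_fin,
    Complex.sub_re, Complex.smul_re, Complex.one_re, Complex.natCast_re, smul_eq_mul]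
  have := re_trace_mul_self_le_one hρ
  have e : 1 / (d : ℝ) * (1 / (d : ℝ) * d) = 1 / (d : ℝ) := by field_simp
  rw [e]
  linarith

/-- For traceless `X` the projector `x x*` may be replaced by `x x* - 1/d` before Cauchy–Schwarz.
The gain `√(1 - 1/d)` is the origin of the factor `√(d/(d-1))` in `f d .frobenius`. -/
lemma re_le_frobeniusNorm (hd : d ≠ 0) {X : Matrix (Fin d) (Fin d) ℂ} (hX : X.trace = 0)
    {x : Fin d → ℂ} (hx : star x ⬝ᵥ x = 1) :
    (star x ⬝ᵥ X.mulVec x).re ≤ √(1 - 1 / (d : ℝ)) * frobeniusNorm X := by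
  have hf := inv_smul_one_sub_frobeniusNorm_le hd (vecMulVec_mem_densityMatrices hx)
  have hh : ((1 / d : ℝ) • (1 : Matrix (Fin d) (Fin d) ℂ) -
      Matrix.vecMulVec x (star x)).IsHermitian :=
    (Matrix.isHermitian_one.smul (IsSelfAdjoint.all _)).sub
      (vecMulVec_mem_densityMatrices hx).1.1
  have hcs := re_trace_conjTranspose_mul_le
    ((1 / d : ℝ) • (1 : Matrix (Fin d) (Fin d) ℂ) - Matrix.vecMulVec x (star x)) (-X)
  have hneg : frobeniusNorm (-X) = frobeniusNorm X := map_neg_eq_map (frobeniusSeminorm (Fin d)) X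
  rw [hh.eq, hneg, Matrix.mul_neg, sub_mul, Matrix.smul_mul, Matrix.one_mul, Matrix.trace_neg,
    Matrix.trace_sub, Matrix.trace_smul, hX, smul_zero, zero_sub, neg_neg, Matrix.trace_mul_comm,
    Matrix.mul_vecMulVec, Matrix.trace_vecMulVec, dotProduct_comm] at hcs
  exact hcs.trans (mul_le_mul_of_nonneg_right hf (frobeniusNorm_nonneg _))

end MixedDistance

/-! ### Suprema of seminorms -/

/-- All functions in the family are Lipschitz with the same constant `2 * M`, hence so is their
supremum. -/
lemma continuous_iSup_seminorm {ι E : Type*} [AddCommGroup E] [Module ℝ E] [Nonempty ι]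
    (p : Seminorm ℝ E) {A B : ι → E} {M : ℝ} (hA : ∀ i, p (A i) ≤ M) (hB : ∀ i, p (B i) ≤ M) :
    Continuous fun s : ℝ => ⨆ i, p ((1 - s) • A i + s • B i) := by
  have hM : 0 ≤ M := (apply_nonneg p _).trans (hA (Classical.arbitrary ι))
  have hbdd : ∀ s : ℝ, BddAbove (Set.range fun i => p ((1 - s) • A i + s • B i)) := fun s => by
    refine ⟨|1 - s| * M + |s| * M, ?_⟩
    rintro _ ⟨i, rfl⟩
    refine (map_add_le_add p _ _).trans ?_
    rw [map_smul_eq_mul, map_smul_eq_mul]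
    exact add_le_add (mul_le_mul_of_nonneg_left (hA i) (abs_nonneg _))
      (mul_le_mul_of_nonneg_left (hB i) (abs_nonneg _))
  refine (LipschitzWith.of_le_add_mul ⟨2 * M, by positivity⟩ fun s t => ?_).continuous
  refine ciSup_le fun i => ?_
  have e : (1 - s) • A i + s • B i = ((1 - t) • A i + t • B i) + (s - t) • (B i - A i) := by
    module
  rw [e]
  refine (map_add_le_add p _ _).trans (add_le_add (le_ciSup (hbdd t) i) ?_)
  rw [map_smul_eq_mul, Real.norm_eq_abs, mul_comm, ← Real.dist_eq]
  refine mul_le_mul_of_nonneg_right ?_ dist_nonneg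
  refine (map_sub_le_add p _ _).trans ?_
  have := add_le_add (hB i) (hA i)
  change _ ≤ 2 * M
  linarith

/-! ### Worst-case figures of merit: bounds and interpolation -/

section Qualities

variable {d : ℕ}

lemma nonempty_densityMatrices (m : Type) [Fintype m] [Nonempty m] :
    Nonempty (densityMatrices m) := by
  classical
  exact ⟨⟨_, single_mem_densityMatrices (Classical.arbitrary m)⟩⟩

/-- All figures of merit other than the fidelity are affine functions of a worst-case seminorm. -/
lemma exists_quality_eq_iSup (hd : d ≠ 0) {k : Merit} (hk : k ≠ .fidelity) :
    ∃ (ι n : Type) (_ : Nonempty ι) (p : Seminorm ℝ (Matrix n n ℂ))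
      (Φ : (Matrix (Fin d) (Fin d) ℂ →ₗ[ℂ] Matrix (Fin d) (Fin d) ℂ) → ι → Matrix n n ℂ) (c M : ℝ),
      0 ≤ c ∧ (∀ L, quality k L = 1 - c * ⨆ i, p (Φ L i)) ∧
      (∀ (s : ℝ) L R i, Φ ((1 - s) • L + s • R) i = (1 - s) • Φ L i + s • Φ R i) ∧
      (∀ L, IsChannel L → ∀ i, p (Φ L i) ≤ M) ∧ (k ≠ .frobenius → c * M ≤ 1) := by
  have : NeZero d := ⟨hd⟩
  have h1 := nonempty_densityMatrices (Fin d)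
  have h2 := nonempty_densityMatrices (Fin d × Fin d)
  cases k with
  | fidelity => exact absurd rfl hk
  | trace =>
    refine ⟨_, _, h1, traceSeminorm (Fin d), fun L ρ => L ρ.1 - ρ.1, 1 / 2, 2, by norm_num,
      fun L => rfl, fun s L R ρ => ?_,
      fun L hL ρ => traceNorm_sub_le_two (hL.mem_densityMatrices ρ.2) ρ.2, by norm_num⟩
    simp only [LinearMap.add_apply, LinearMap.smul_apply]
    module
  | frobenius =>
    refine ⟨_, _, h1, frobeniusSeminorm (Fin d), fun L ρ => L ρ.1 - ρ.1, 1, 2, by norm_num,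
      fun L => by rw [one_mul]; rfl, fun s L R ρ => ?_,
      fun L hL ρ => frobeniusNorm_sub_le_two (hL.mem_densityMatrices ρ.2) ρ.2, by simp⟩
    simp only [LinearMap.add_apply, LinearMap.smul_apply]
    module
  | operator =>
    refine ⟨_, _, h1, operatorSeminorm (Fin d), fun L ρ => L ρ.1 - ρ.1, 1, 1, by norm_num,
      fun L => by rw [one_mul]; rfl, fun s L R ρ => ?_,
      fun L hL ρ => operatorNorm_sub_le_one (hL.mem_densityMatrices ρ.2) ρ.2, by simp⟩
    simp only [LinearMap.add_apply, LinearMap.smul_apply]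
    module
  | diamond =>
    refine ⟨_, _, h2, traceSeminorm (Fin d × Fin d), fun L ρ => idTensor (Fin d) L ρ.1 - ρ.1,
      1 / 2, 2, by norm_num, fun L => rfl, fun s L R ρ => ?_,
      fun L hL ρ => traceNorm_sub_le_two (hL.idTensor_mem_densityMatrices ρ.2) ρ.2, by norm_num⟩
    have : idTensor (Fin d) ((1 - s) • L + s • R) ρ.1 =
        (1 - s) • idTensor (Fin d) L ρ.1 + s • idTensor (Fin d) R ρ.1 := by
      ext p q; simp [idTensor]
    simp only [this]
    module

lemma quality_le_one (hd : d ≠ 0) {k : Merit} (hk : k ≠ .fidelity)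
    (L : Matrix (Fin d) (Fin d) ℂ →ₗ[ℂ] Matrix (Fin d) (Fin d) ℂ) : quality k L ≤ 1 := by
  obtain ⟨ι, n, _, p, Φ, c, M, hc, hq, -⟩ := exists_quality_eq_iSup hd hk
  rw [hq]
  have := mul_nonneg hc (Real.iSup_nonneg fun i => apply_nonneg p (Φ L i))
  linarith

lemma quality_nonneg (hd : d ≠ 0) {k : Merit} (hk : k ≠ .fidelity) (hk' : k ≠ .frobenius)
    {L : Matrix (Fin d) (Fin d) ℂ →ₗ[ℂ] Matrix (Fin d) (Fin d) ℂ} (hL : IsChannel L) :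
    0 ≤ quality k L := by
  obtain ⟨ι, n, _, p, Φ, c, M, hc, hq, -, hM, hcM⟩ := exists_quality_eq_iSup hd hk
  rw [hq]
  have := mul_le_mul_of_nonneg_left (ciSup_le (hM L hL)) hc
  linarith [hcM hk']

/-- A worst-case quality need not be affine along a segment of channels, so an intermediate value is
found by continuity. -/
lemma exists_quality_combination_eq (hd : d ≠ 0) {k : Merit} (hk : k ≠ .fidelity)
    {L R : Matrix (Fin d) (Fin d) ℂ →ₗ[ℂ] Matrix (Fin d) (Fin d) ℂ} (hL : IsChannel L)
    (hR : IsChannel R) {x : ℝ} (hRx : quality k R ≤ x) (hxL : x ≤ quality k L) :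
    ∃ s : ℝ, 0 ≤ s ∧ s ≤ 1 ∧ quality k ((1 - s) • L + s • R) = x := by
  obtain ⟨ι, n, _, p, Φ, c, M, hc, hq, hΦ, hM, -⟩ := exists_quality_eq_iSup hd hk
  have hcont : Continuous fun s : ℝ => quality k ((1 - s) • L + s • R) := by
    simp only [hq, hΦ]
    exact continuous_const.sub (continuous_const.mul (continuous_iSup_seminorm p (hM L hL) (hM R hR)))
  obtain ⟨s, hs, h⟩ := intermediate_value_Icc' (zero_le_one' ℝ) hcont.continuousOn
    (show x ∈ _ from ⟨by simpa using hRx, by simpa using hxL⟩)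
  exact ⟨s, hs.1, hs.2, h⟩

end Qualities

/-! ### Comparing the figures of merit with the fidelity -/

section Comparison

variable {d : ℕ}

lemma quality_trace_le {L : Matrix (Fin d) (Fin d) ℂ →ₗ[ℂ] Matrix (Fin d) (Fin d) ℂ}
    (hL : IsChannel L) {ρ : Matrix (Fin d) (Fin d) ℂ} (hρ : ρ ∈ densityMatrices (Fin d)) :
    quality .trace L ≤ 1 - 1 / 2 * traceNorm (L ρ - ρ) := by
  have := le_ciSup (f := fun ρ : densityMatrices (Fin d) => traceNorm (L ρ.1 - ρ.1))
    ⟨2, by rintro _ ⟨ρ, rfl⟩; exact traceNorm_sub_le_two (hL.mem_densityMatrices ρ.2) ρ.2⟩ ⟨ρ, hρ⟩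
  rw [quality]
  dsimp only at this
  linarith

lemma quality_frobenius_le {L : Matrix (Fin d) (Fin d) ℂ →ₗ[ℂ] Matrix (Fin d) (Fin d) ℂ}
    (hL : IsChannel L) {ρ : Matrix (Fin d) (Fin d) ℂ} (hρ : ρ ∈ densityMatrices (Fin d)) :
    quality .frobenius L ≤ 1 - frobeniusNorm (L ρ - ρ) := by
  have := le_ciSup (f := fun ρ : densityMatrices (Fin d) => frobeniusNorm (L ρ.1 - ρ.1))
    ⟨2, by rintro _ ⟨ρ, rfl⟩; exact frobeniusNorm_sub_le_two (hL.mem_densityMatrices ρ.2) ρ.2⟩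
    ⟨ρ, hρ⟩
  rw [quality]
  dsimp only at this
  linarith

lemma quality_operator_le {L : Matrix (Fin d) (Fin d) ℂ →ₗ[ℂ] Matrix (Fin d) (Fin d) ℂ}
    (hL : IsChannel L) {ρ : Matrix (Fin d) (Fin d) ℂ} (hρ : ρ ∈ densityMatrices (Fin d)) :
    quality .operator L ≤ 1 - operatorNorm (L ρ - ρ) := by
  have := le_ciSup (f := fun ρ : densityMatrices (Fin d) => operatorNorm (L ρ.1 - ρ.1))
    ⟨1, by rintro _ ⟨ρ, rfl⟩; exact operatorNorm_sub_le_one (hL.mem_densityMatrices ρ.2) ρ.2⟩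
    ⟨ρ, hρ⟩
  rw [quality]
  dsimp only at this
  linarith

lemma quality_diamond_le {L : Matrix (Fin d) (Fin d) ℂ →ₗ[ℂ] Matrix (Fin d) (Fin d) ℂ}
    (hL : IsChannel L) {ρ : Matrix (Fin d × Fin d) (Fin d × Fin d) ℂ}
    (hρ : ρ ∈ densityMatrices (Fin d × Fin d)) :
    quality .diamond L ≤ 1 - 1 / 2 * traceNorm (idTensor (Fin d) L ρ - ρ) := by
  have := le_ciSup
    (f := fun ρ : densityMatrices (Fin d × Fin d) => traceNorm (idTensor (Fin d) L ρ.1 - ρ.1))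
    ⟨2, by
      rintro _ ⟨ρ, rfl⟩
      exact traceNorm_sub_le_two (hL.idTensor_mem_densityMatrices ρ.2) ρ.2⟩ ⟨ρ, hρ⟩
  rw [quality]
  dsimp only at this
  linarith

lemma IsChannel.trace_sub_eq_zero {L : Matrix (Fin d) (Fin d) ℂ →ₗ[ℂ] Matrix (Fin d) (Fin d) ℂ}
    (hL : IsChannel L) (X : Matrix (Fin d) (Fin d) ℂ) : (X - L X).trace = 0 := by
  rw [Matrix.trace_sub, hL.2, sub_self]

/-- The matrix `x x* - L (x x*)` is traceless with expectation `1 - pureFidelity L x` at `x`, so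
`two_mul_le_traceNorm` bounds its trace norm below. -/
lemma quality_trace_le_pureFidelity
    {L : Matrix (Fin d) (Fin d) ℂ →ₗ[ℂ] Matrix (Fin d) (Fin d) ℂ} (hL : IsChannel L)
    {x : Fin d → ℂ} (hx : star x ⬝ᵥ x = 1) : quality .trace L ≤ (pureFidelity L x).re := by
  have h1 := quality_trace_le hL (vecMulVec_mem_densityMatrices hx)
  have h2 := two_mul_le_traceNorm (hL.trace_sub_eq_zero (Matrix.vecMulVec x (star x))) hx
  rw [Matrix.sub_mulVec, dotProduct_sub, star_dotProduct_vecMulVec_mulVec hx, Complex.sub_re,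
    Complex.one_re, ← pureFidelity] at h2
  have h3 : traceNorm (L (Matrix.vecMulVec x (star x)) - Matrix.vecMulVec x (star x)) =
    traceNorm (Matrix.vecMulVec x (star x) - L (Matrix.vecMulVec x (star x))) :=
    map_sub_rev (traceSeminorm (Fin d)) _ _
  linarith

lemma quality_operator_le_pureFidelity
    {L : Matrix (Fin d) (Fin d) ℂ →ₗ[ℂ] Matrix (Fin d) (Fin d) ℂ} (hL : IsChannel L)
    {x : Fin d → ℂ} (hx : star x ⬝ᵥ x = 1) : quality .operator L ≤ (pureFidelity L x).re := by
  have h1 := quality_operator_le hL (vecMulVec_mem_densityMatrices hx)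
  have h2 := re_le_operatorNorm (Matrix.vecMulVec x (star x) - L (Matrix.vecMulVec x (star x))) hx
  rw [Matrix.sub_mulVec, dotProduct_sub, star_dotProduct_vecMulVec_mulVec hx, Complex.sub_re,
    Complex.one_re, ← pureFidelity] at h2
  have h3 : operatorNorm (L (Matrix.vecMulVec x (star x)) - Matrix.vecMulVec x (star x)) =
    operatorNorm (Matrix.vecMulVec x (star x) - L (Matrix.vecMulVec x (star x))) :=
    map_sub_rev (operatorSeminorm (Fin d)) _ _
  linarith

lemma quality_frobenius_le_pureFidelity (hd : d ≠ 0)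
    {L : Matrix (Fin d) (Fin d) ℂ →ₗ[ℂ] Matrix (Fin d) (Fin d) ℂ} (hL : IsChannel L)
    {x : Fin d → ℂ} (hx : star x ⬝ᵥ x = 1) :
    1 - (pureFidelity L x).re ≤ √(1 - 1 / (d : ℝ)) * (1 - quality .frobenius L) := by
  have h1 := quality_frobenius_le hL (vecMulVec_mem_densityMatrices hx)
  have h2 := re_le_frobeniusNorm hd (hL.trace_sub_eq_zero (Matrix.vecMulVec x (star x))) hx
  rw [Matrix.sub_mulVec, dotProduct_sub, star_dotProduct_vecMulVec_mulVec hx, Complex.sub_re,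
    Complex.one_re, ← pureFidelity] at h2
  have h3 : frobeniusNorm (L (Matrix.vecMulVec x (star x)) - Matrix.vecMulVec x (star x)) =
    frobeniusNorm (Matrix.vecMulVec x (star x) - L (Matrix.vecMulVec x (star x))) :=
    map_sub_rev (frobeniusSeminorm (Fin d)) _ _
  rw [h3] at h1
  exact h2.trans (mul_le_mul_of_nonneg_left (by linarith) (Real.sqrt_nonneg _))

/-- The same argument with `Ω` as the input state; no averaging over pure states is needed. -/
lemma quality_diamond_le_fidelity (hd : d ≠ 0)
    {L : Matrix (Fin d) (Fin d) ℂ →ₗ[ℂ] Matrix (Fin d) (Fin d) ℂ} (hL : IsChannel L) :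
    quality .diamond L ≤ quality .fidelity L := by
  have hx := star_omegaVec_dotProduct_self hd
  have hΩ := omega_mem_densityMatrices hd
  have h1 := quality_diamond_le hL hΩ
  have h2 := two_mul_le_traceNorm (X := Matrix.vecMulVec (omegaVec d) (star (omegaVec d)) -
    idTensor (Fin d) L (Matrix.vecMulVec (omegaVec d) (star (omegaVec d))))
    (by rw [Matrix.trace_sub, trace_idTensor hL.2, sub_self]) hx
  rw [Matrix.sub_mulVec, dotProduct_sub, star_dotProduct_vecMulVec_mulVec hx, Complex.sub_re,
    Complex.one_re] at h2
  have h3 := map_sub_rev (traceSeminorm (Fin d × Fin d))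
    (idTensor (Fin d) L (Matrix.vecMulVec (omegaVec d) (star (omegaVec d))))
    (Matrix.vecMulVec (omegaVec d) (star (omegaVec d)))
  change traceNorm _ = traceNorm _ at h3
  change _ ≤ (star (omegaVec d) ⬝ᵥ (idTensor (Fin d) L (Matrix.vecMulVec (omegaVec d)
    (star (omegaVec d)))).mulVec (omegaVec d)).re
  linarith

lemma slope_frobenius_eq (hd : 2 ≤ d) :
    slope d .frobenius * √(1 - 1 / (d : ℝ)) = ((d : ℝ) ^ 2 - 1) / (d : ℝ) ^ 2 ∧
      slope d .frobenius = ((d : ℝ) + 1) / d * √(1 - 1 / (d : ℝ)) := by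
  have h2 : (2 : ℝ) ≤ d := by exact_mod_cast hd
  have hd1 : (0 : ℝ) < d - 1 := by linarith
  have e : √((d : ℝ) / (d - 1)) * √(1 - 1 / (d : ℝ)) = 1 := by
    rw [← Real.sqrt_mul (by positivity)]
    have : (d : ℝ) / (d - 1) * (1 - 1 / (d : ℝ)) = 1 := by field_simp
    rw [this, Real.sqrt_one]
  have e1 : slope d .frobenius * √(1 - 1 / (d : ℝ)) = ((d : ℝ) ^ 2 - 1) / (d : ℝ) ^ 2 := by
    rw [slope, mul_assoc, e, mul_one]
  refine ⟨e1, ?_⟩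
  have h0 : 0 ≤ 1 - 1 / (d : ℝ) := by
    rw [sub_nonneg, div_le_one (by linarith)]; linarith
  have hne : √(1 - 1 / (d : ℝ)) ≠ 0 := right_ne_zero_of_mul (e.symm ▸ one_ne_zero)
  rw [← mul_left_inj' hne, e1, mul_assoc, Real.mul_self_sqrt h0]
  field_simp
  ring

/-- No figure of merit exceeds the value determined by the entanglement fidelity. -/
lemma f_quality_le (hd : 2 ≤ d) {k : Merit} (hk : k ≠ .fidelity)
    {L : Matrix (Fin d) (Fin d) ℂ →ₗ[ℂ] Matrix (Fin d) (Fin d) ℂ} (hL : IsChannel L) :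
    f d k (quality k L) ≤ quality .fidelity L := by
  have h2 : (2 : ℝ) ≤ d := by exact_mod_cast hd
  have hdp : (0 : ℝ) < d := by linarith
  have hd0 : d ≠ 0 := by omega
  obtain ⟨x, hx, hF⟩ := exists_pureFidelity_le hd0 hL.2
  set q := (pureFidelity L x).re
  -- The relation between average pure-state fidelity and entanglement fidelity, solved for the
  -- latter; the left side is `f d .trace q`.
  have key : 1 - (1 + (d : ℝ)) / d * (1 - q) ≤ quality .fidelity L := by
    have : 1 - (1 + (d : ℝ)) / d * (1 - q) = (q * (d + 1) - 1) / d := by field_simp; ring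
    rw [this, div_le_iff₀ hdp]; linarith
  have hpos : 0 < (1 + (d : ℝ)) / d := by positivity
  cases k with
  | fidelity => exact absurd rfl hk
  | trace =>
    have := mul_le_mul_of_nonneg_left (quality_trace_le_pureFidelity hL hx) hpos.le
    change 1 + (1 + (d : ℝ)) / d * _ ≤ _
    linarith
  | operator =>
    have := mul_le_mul_of_nonneg_left (quality_operator_le_pureFidelity hL hx) hpos.le
    change 1 + (1 + (d : ℝ)) / d * _ ≤ _
    linarith
  | frobenius =>
    have := mul_le_mul_of_nonneg_left (quality_frobenius_le_pureFidelity hd0 hL hx) hpos.le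
    rw [f_eq_slope, (slope_frobenius_eq hd).2, add_comm (d : ℝ) 1]
    linarith
  | diamond => exact quality_diamond_le_fidelity hd0 hL

/-! ### Channels attaining the bounds: depolarizing and constant channels -/

/-- The channel whose Choi matrix is the normalised projection onto the complement of `Ω`. -/
noncomputable def complementMap (d : ℕ) : Matrix (Fin d) (Fin d) ℂ →ₗ[ℂ] Matrix (Fin d) (Fin d) ℂ :=
  ((1 / ((d : ℝ) ^ 2 - 1) : ℝ) : ℂ) •
    ((d : ℂ) • (Matrix.traceLinearMap (Fin d) ℂ ℂ).smulRight 1 - LinearMap.id)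

lemma complementMap_apply (X : Matrix (Fin d) (Fin d) ℂ) : complementMap d X =
    ((1 / ((d : ℝ) ^ 2 - 1) : ℝ) : ℂ) • ((d : ℂ) • X.trace • (1 : Matrix (Fin d) (Fin d) ℂ) - X) :=
  rfl

lemma smul_mul_mul_conjTranspose_smul {m n : Type} [Fintype m] (c : ℝ) (K : Matrix n m ℂ)
    (X : Matrix m m ℂ) : ((c : ℂ) • K) * X * ((c : ℂ) • K).conjTranspose =
      ((c ^ 2 : ℝ) : ℂ) • (K * X * K.conjTranspose) := by
  rw [Matrix.conjTranspose_smul, Matrix.smul_mul, Matrix.smul_mul, Matrix.mul_smul, smul_smul,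
    RCLike.star_def, Complex.conj_ofReal, sq, Complex.ofReal_mul]

/-- Conjugation by diagonal matrices multiplies entrywise, here by `2 (d · 1 - J)` with `J` the
all-ones matrix. -/
lemma sum_diagonal_kraus (X : Matrix (Fin d) (Fin d) ℂ) :
    ∑ p : Fin d × Fin d, Matrix.diagonal (Pi.single p.1 1 - Pi.single p.2 1) * X *
      (Matrix.diagonal (Pi.single p.1 1 - Pi.single p.2 1)).conjTranspose =
      Matrix.of fun a b => (if a = b then 2 * (d : ℂ) * X a b else 0) - 2 * X a b := by
  ext a b
  simp only [Matrix.sum_apply, Matrix.diagonal_conjTranspose, Matrix.mul_diagonal,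
    Matrix.diagonal_mul, Fintype.sum_prod_type, Pi.sub_apply, Pi.star_apply, star_sub,
    Pi.single_apply, Matrix.of_apply, apply_ite star, star_one, star_zero, sub_mul, mul_sub,
    ite_mul, mul_ite, one_mul, zero_mul, mul_one, mul_zero, Finset.sum_sub_distrib,
    Finset.sum_ite_irrel, Finset.sum_const_zero, Finset.sum_ite_eq, Finset.mem_univ, if_true]
  by_cases h : a = b
  · subst h; simp; ring
  · simp [h]; ring

lemma sum_single_kraus (X : Matrix (Fin d) (Fin d) ℂ) :
    ∑ p : Fin d × Fin d, (if p.1 = p.2 then 0 else Matrix.single p.1 p.2 1) * X *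
      (if p.1 = p.2 then 0 else Matrix.single p.1 p.2 (1 : ℂ)).conjTranspose =
      Matrix.of fun a b => if a = b then X.trace - X a a else 0 := by
  have h : ∀ p : Fin d × Fin d, (if p.1 = p.2 then 0 else Matrix.single p.1 p.2 1) * X *
      (if p.1 = p.2 then 0 else Matrix.single p.1 p.2 (1 : ℂ)).conjTranspose =
      Matrix.single p.1 p.1 (X p.2 p.2) -
        if p.1 = p.2 then Matrix.single p.1 p.1 (X p.2 p.2) else 0 := fun p => by
    split_ifs with h
    · simp
    · simp only [Matrix.conjTranspose_single, star_one, Matrix.single_mul_mul_single, one_mul,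
        mul_one, sub_zero]
  simp only [h, Finset.sum_sub_distrib, Fintype.sum_prod_type, Finset.sum_ite_eq, Finset.mem_univ,
    if_true]
  ext a b
  simp only [Matrix.sub_apply, Matrix.sum_apply, Matrix.single_apply, Matrix.of_apply]
  by_cases hab : a = b
  · subst hab
    simp [Finset.sum_ite_irrel, Matrix.trace]
  · have : ∀ j, ¬(j = a ∧ j = b) := fun j hj => hab (hj.1.symm.trans hj.2)
    simp [hab, this]

lemma isChannel_complementMap (hd : 2 ≤ d) : IsChannel (complementMap d) := by
  have h2 : (2 : ℝ) ≤ d := by exact_mod_cast hd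
  have hpos : 0 < (d : ℝ) ^ 2 - 1 := by nlinarith
  constructor
  -- The map `d (tr X) 1 - X` is half the diagonal Kraus sum plus `d` times the sum over the
  -- off-diagonal matrix units.
  · refine isCompletelyPositive_of_kraus (κ := (Fin d × Fin d) ⊕ (Fin d × Fin d)) _
      (Sum.elim
        (fun p => ((√(1 / ((d : ℝ) ^ 2 - 1) / 2) : ℝ) : ℂ) •
          Matrix.diagonal (Pi.single p.1 1 - Pi.single p.2 1))
        (fun p => ((√(1 / ((d : ℝ) ^ 2 - 1) * d) : ℝ) : ℂ) •
          if p.1 = p.2 then 0 else Matrix.single p.1 p.2 1)) fun X => ?_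
    rw [complementMap_apply]
    simp only [Fintype.sum_sum_type, Sum.elim_inl, Sum.elim_inr, smul_mul_mul_conjTranspose_smul]
    rw [Real.sq_sqrt (by positivity), Real.sq_sqrt (by positivity), ← Finset.smul_sum,
      ← Finset.smul_sum, sum_diagonal_kraus, sum_single_kraus]
    ext a b
    simp only [Matrix.smul_apply, Matrix.sub_apply, Matrix.add_apply, Matrix.of_apply,
      Matrix.one_apply, smul_eq_mul]
    push_cast
    split_ifs with h
    · subst h; ring
    · ring
  · intro X
    have : ((d : ℂ) ^ 2 - 1) ≠ 0 := by exact_mod_cast hpos.ne'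
    rw [complementMap_apply, Matrix.trace_smul, Matrix.trace_sub, Matrix.trace_smul,
      Matrix.trace_smul, Matrix.trace_one, Fintype.card_fin]
    simp only [smul_eq_mul]
    push_cast
    field_simp

/-- Depolarizing channels attain the value determined by the entanglement fidelity. -/
lemma le_f_quality (hd : 2 ≤ d) {k : Merit} (hk : k ≠ .fidelity)
    {L : Matrix (Fin d) (Fin d) ℂ →ₗ[ℂ] Matrix (Fin d) (Fin d) ℂ} {q : ℝ} (hq : 0 ≤ q)
    (hL : ∀ X, L X = (1 - q : ℝ) • X + (q / d : ℝ) • X.trace • (1 : Matrix (Fin d) (Fin d) ℂ)) :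
    1 - q * (1 - 1 / (d : ℝ) ^ 2) ≤ f d k (quality k L) := by
  have h2 : (2 : ℝ) ≤ d := by exact_mod_cast hd
  have hdp : (0 : ℝ) < d := by linarith
  have hd0 : d ≠ 0 := by omega
  have : NeZero d := ⟨hd0⟩
  have i1 := nonempty_densityMatrices (Fin d)
  have i2 := nonempty_densityMatrices (Fin d × Fin d)
  have hdiff : ∀ ρ ∈ densityMatrices (Fin d), L ρ - ρ =
      q • ((1 / d : ℝ) • (1 : Matrix (Fin d) (Fin d) ℂ) - ρ) := fun ρ hρ => by
    rw [hL, hρ.2, one_smul, smul_sub, smul_smul, sub_smul, one_smul, mul_one_div]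
    abel
  have hs := one_le_slope hd k
  have hsp : 0 ≤ slope d k := zero_le_one.trans hs
  suffices h : slope d k * (1 - quality k L) ≤ q * (1 - 1 / (d : ℝ) ^ 2) by
    rw [f_eq_slope]; linarith
  cases k with
  | fidelity => exact absurd rfl hk
  | trace =>
    have hsup : ⨆ ρ : densityMatrices (Fin d), traceNorm (L ρ.1 - ρ.1) ≤
        q * (2 * (1 - 1 / (d : ℝ))) := ciSup_le fun ρ => by
      rw [hdiff _ ρ.2, traceNorm_smul, abs_of_nonneg hq]
      exact mul_le_mul_of_nonneg_left (inv_smul_one_sub_traceNorm_le hd0 ρ.2) hq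
    have : 1 - quality .trace L ≤ q * (1 - 1 / (d : ℝ)) := by rw [quality]; linarith
    refine (mul_le_mul_of_nonneg_left this hsp).trans (le_of_eq ?_)
    rw [slope]; field_simp; ring
  | operator =>
    have hsup : ⨆ ρ : densityMatrices (Fin d), operatorNorm (L ρ.1 - ρ.1) ≤
        q * (1 - 1 / (d : ℝ)) := ciSup_le fun ρ => by
      rw [hdiff _ ρ.2]
      refine (map_smul_eq_mul (operatorSeminorm (Fin d)) _ _).trans_le ?_
      rw [Real.norm_eq_abs, abs_of_nonneg hq]
      exact mul_le_mul_of_nonneg_left (inv_smul_one_sub_operatorNorm_le hd ρ.2) hq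
    have : 1 - quality .operator L ≤ q * (1 - 1 / (d : ℝ)) := by rw [quality]; linarith
    refine (mul_le_mul_of_nonneg_left this hsp).trans (le_of_eq ?_)
    rw [slope]; field_simp; ring
  | frobenius =>
    have hsup : ⨆ ρ : densityMatrices (Fin d), frobeniusNorm (L ρ.1 - ρ.1) ≤
        q * √(1 - 1 / (d : ℝ)) := ciSup_le fun ρ => by
      rw [hdiff _ ρ.2]
      refine (map_smul_eq_mul (frobeniusSeminorm (Fin d)) _ _).trans_le ?_
      rw [Real.norm_eq_abs, abs_of_nonneg hq]
      exact mul_le_mul_of_nonneg_left (inv_smul_one_sub_frobeniusNorm_le hd0 ρ.2) hq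
    have : 1 - quality .frobenius L ≤ q * √(1 - 1 / (d : ℝ)) := by rw [quality]; linarith
    refine (mul_le_mul_of_nonneg_left this hsp).trans (le_of_eq ?_)
    rw [mul_left_comm, (slope_frobenius_eq hd).1]; field_simp
  | diamond =>
    have hpos : 0 < (d : ℝ) ^ 2 - 1 := by nlinarith
    -- `q'` is the infidelity of `L`. Writing `L` as the combination of the identity and the channel
    -- `complementMap d` with weights `1 - q'` and `q'` bounds the diamond distance by `2 * q'`.
    set q' := q * (1 - 1 / (d : ℝ) ^ 2) with hq'
    have hq'0 : 0 ≤ q' := mul_nonneg hq (one_sub_inv_sq_pos hd).le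
    have hL' : L = (1 - q') • LinearMap.id + q' • complementMap d := by
      apply LinearMap.ext; intro X
      rw [hL, LinearMap.add_apply, LinearMap.smul_apply, LinearMap.smul_apply, complementMap_apply]
      have e1 : (1 - q : ℝ) = (1 - q') - q' * (1 / ((d : ℝ) ^ 2 - 1)) := by
        rw [hq']; field_simp; ring
      have e2 : q / d = q' * (1 / ((d : ℝ) ^ 2 - 1)) * d := by
        rw [hq']; field_simp
      rw [e1, e2]
      ext i j
      simp
      ring
    have hdiff' : ∀ ρ : Matrix (Fin d × Fin d) (Fin d × Fin d) ℂ, idTensor (Fin d) L ρ - ρ =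
        q' • (idTensor (Fin d) (complementMap d) ρ - ρ) := fun ρ => by
      ext p r
      simp [hL', idTensor]
      ring
    have hsup : ⨆ ρ : densityMatrices (Fin d × Fin d), traceNorm (idTensor (Fin d) L ρ.1 - ρ.1) ≤
        q' * 2 := ciSup_le fun ρ => by
      rw [hdiff', traceNorm_smul, abs_of_nonneg hq'0]
      exact mul_le_mul_of_nonneg_left (traceNorm_sub_le_two
        ((isChannel_complementMap hd).idTensor_mem_densityMatrices ρ.2) ρ.2) hq'0
    rw [slope, one_mul, quality]
    linarith

lemma star_single_dotProduct_mulVec {m : Type} [Fintype m] [DecidableEq m] (X : Matrix m m ℂ)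
    (z : m) : star (Pi.single z 1 : m → ℂ) ⬝ᵥ X.mulVec (Pi.single z 1) = X z z := by
  rw [star_single_one]
  simp

/-- A basis state `w ≠ z` is sent to an orthogonal state. In the Frobenius case the value is
negative, but non-positivity is all the interpolation needs. -/
lemma quality_constantMap_nonpos (hd : 2 ≤ d) {k : Merit} (hk : k ≠ .fidelity) (z : Fin d) :
    quality k (constantMap z) ≤ 0 := by
  have h2 : (2 : ℝ) ≤ d := by exact_mod_cast hd
  have hd0 : d ≠ 0 := by omega
  have : Nontrivial (Fin d) := Fin.nontrivial_iff_two_le.2 hd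
  obtain ⟨w, hw⟩ := exists_ne z
  have hc := isChannel_constantMap z
  have hρ := single_mem_densityMatrices w
  have hz : star (Pi.single z 1 : Fin d → ℂ) ⬝ᵥ Pi.single z 1 = 1 := by
    simp
  have htr : (constantMap z (Matrix.single w w 1) - Matrix.single w w 1).trace = 0 := by
    rw [Matrix.trace_sub, hc.2, sub_self]
  have hval : (star (Pi.single z 1 : Fin d → ℂ) ⬝ᵥ
      (constantMap z (Matrix.single w w 1) - Matrix.single w w 1).mulVec (Pi.single z 1)).re = 1 := by
    rw [star_single_dotProduct_mulVec, constantMap_apply]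
    simp [hw]
  cases k with
  | fidelity => exact absurd rfl hk
  | trace =>
    have h := two_mul_le_traceNorm htr hz
    rw [hval] at h
    linarith [quality_trace_le hc hρ]
  | operator =>
    have h := re_le_operatorNorm (constantMap z (Matrix.single w w 1) - Matrix.single w w 1) hz
    rw [hval] at h
    linarith [quality_operator_le hc hρ]
  | frobenius =>
    have h := re_le_frobeniusNorm hd0 htr hz
    rw [hval] at h
    have h1 : √(1 - 1 / (d : ℝ)) ≤ 1 := by
      have : 0 ≤ 1 / (d : ℝ) := by positivity
      exact (Real.sqrt_le_sqrt (by linarith)).trans_eq Real.sqrt_one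
    have h3 := mul_le_of_le_one_left (frobeniusNorm_nonneg
      (constantMap z (Matrix.single w w 1) - Matrix.single w w 1)) h1
    linarith [quality_frobenius_le hc hρ]
  | diamond =>
    have hz2 : star (Pi.single (z, z) 1 : Fin d × Fin d → ℂ) ⬝ᵥ Pi.single (z, z) 1 = 1 := by
      simp
    have hρ2 := single_mem_densityMatrices (z, w)
    have h := two_mul_le_traceNorm (X := idTensor (Fin d) (constantMap z)
      (Matrix.single (z, w) (z, w) 1) - Matrix.single (z, w) (z, w) 1)
      (by rw [Matrix.trace_sub, trace_idTensor hc.2, sub_self]) hz2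
    have hval2 : (star (Pi.single (z, z) 1 : Fin d × Fin d → ℂ) ⬝ᵥ (idTensor (Fin d) (constantMap z)
      (Matrix.single (z, w) (z, w) 1) - Matrix.single (z, w) (z, w) 1).mulVec
        (Pi.single (z, z) 1)).re = 1 := by
      rw [star_single_dotProduct_mulVec]
      simp only [Matrix.sub_apply, idTensor, Matrix.of_apply, constantMap_apply]
      simp [hw, Matrix.trace, Matrix.single_apply]
    rw [hval2] at h
    linarith [quality_diamond_le hc hρ2]

end Comparison

/-! ### The achievable region -/

section Region

variable {d : ℕ}

lemma qualities_swapFactors (k : Merit) (T : CloningMap d) :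
    qualities k (swapFactors (Fin d) (Fin d) ∘ₗ T) = (qualities k T).swap := rfl

/-- Mixing `T` with its reset version moves the first marginal towards a constant channel of
non-positive quality while the second stays fixed. -/
lemma exists_lower_fst (hd : 2 ≤ d) {k : Merit} (hk : k ≠ .fidelity) {T : CloningMap d}
    (hT : IsChannel T) {x : ℝ} (hx : 0 ≤ x) (hxT : x ≤ (qualities k T).1) :
    ∃ T' : CloningMap d, IsChannel T' ∧ qualities k T' = (x, (qualities k T).2) := by
  have : NeZero d := ⟨by omega⟩
  have hR : IsChannel (resetFst (0 : Fin d) ∘ₗ T) := (isChannel_resetFst 0).comp hT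
  obtain ⟨s, hs0, hs1, h⟩ := exists_quality_combination_eq (by omega) hk hT.marginal₁
    (isChannel_constantMap (0 : Fin d)) ((quality_constantMap_nonpos hd hk 0).trans hx) hxT
  refine ⟨(1 - s) • T + s • (resetFst 0 ∘ₗ T),
    hT.convex hR (sub_nonneg.2 hs1) hs0 (sub_add_cancel 1 s), ?_⟩
  rw [qualities, marginal₁_combination, marginal₂_combination, marginal₁_resetFst 0 hT,
    marginal₂_resetFst, h, ← add_smul, sub_add_cancel, one_smul]
  rfl

lemma exists_lower (hd : 2 ≤ d) {k : Merit} (hk : k ≠ .fidelity) {T : CloningMap d}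
    (hT : IsChannel T) {x y : ℝ} (hx : 0 ≤ x) (hxT : x ≤ (qualities k T).1) (hy : 0 ≤ y)
    (hyT : y ≤ (qualities k T).2) :
    ∃ T' : CloningMap d, IsChannel T' ∧ qualities k T' = (x, y) := by
  obtain ⟨T₁, hT₁, h₁⟩ := exists_lower_fst hd hk hT hx hxT
  obtain ⟨T₂, hT₂, h₂⟩ := exists_lower_fst (x := y) hd hk (isChannel_swapFactors.comp hT₁) hy
    (by rw [qualities_swapFactors, h₁]; exact hyT)
  refine ⟨_, isChannel_swapFactors.comp hT₂, ?_⟩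
  rw [qualities_swapFactors, h₂, qualities_swapFactors, h₁]
  rfl

/-- Every boundary pair of fidelities belongs to a cloning channel with depolarizing marginals. -/
lemma exists_cloner_params (hd : 2 ≤ d) {x y : ℝ} (hx : 0 ≤ x) (hy : 0 ≤ y) (h : g d x y = 0) :
    ∃ a b : ℝ, a ^ 2 + b ^ 2 + 2 * a * b / d = 1 ∧
      1 - b ^ 2 * (1 - 1 / (d : ℝ) ^ 2) = x ∧ 1 - a ^ 2 * (1 - 1 / (d : ℝ) ^ 2) = y := by
  have h2 : (2 : ℝ) ≤ d := by exact_mod_cast hd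
  have hdp : (d : ℝ) ≠ 0 := by linarith
  have hpos : (d : ℝ) ^ 2 - 1 ≠ 0 := by nlinarith
  have hg := (g_eq_zero_iff hd hx hy).1 h
  obtain ⟨s, hs, rfl⟩ : ∃ s, 0 ≤ s ∧ s ^ 2 = x := ⟨√x, Real.sqrt_nonneg _, Real.sq_sqrt hx⟩
  obtain ⟨t, ht, rfl⟩ : ∃ t, 0 ≤ t ∧ t ^ 2 = y := ⟨√y, Real.sqrt_nonneg _, Real.sq_sqrt hy⟩
  rw [Real.sqrt_sq hs, Real.sqrt_sq ht] at hg
  have hg' : (d : ℝ) ^ 2 * (s ^ 2 + t ^ 2) - 2 * d * (s * t) = d ^ 2 - 1 := by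
    field_simp at hg
    linarith
  -- These solve the linear system `s = a + b/d`, `t = b + a/d` for the amplitudes `s = √x` and `t =
  -- √y`.
  refine ⟨(d ^ 2 * s - d * t) / (d ^ 2 - 1), (d ^ 2 * t - d * s) / (d ^ 2 - 1), ?_, ?_, ?_⟩
  · field_simp
    linear_combination ((d : ℝ) ^ 2 - 1) * hg'
  · field_simp
    linear_combination (-1 : ℝ) * hg'
  · field_simp
    linear_combination (-1 : ℝ) * hg'

lemma exists_channel_of_boundary (hd : 2 ≤ d) {x y : ℝ} (hx : 0 ≤ x) (hy : 0 ≤ y)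
    (h : g d x y = 0) : ∃ T : CloningMap d, IsChannel T ∧ qualities .fidelity T = (x, y) ∧
      ∀ k, k ≠ .fidelity → x ≤ f d k (qualities k T).1 ∧ y ≤ f d k (qualities k T).2 := by
  obtain ⟨a, b, hab, h₁, h₂⟩ := exists_cloner_params hd hx hy h
  refine ⟨cloner d a b, isChannel_cloner hab, ?_, fun k hk => ?_⟩
  · rw [qualities, quality_fidelity_depolarizing (by omega) _ (marginal₁_cloner a b hab),
      quality_fidelity_depolarizing (by omega) _ (marginal₂_cloner a b hab), h₁, h₂]
  · rw [← h₁, ← h₂]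
    exact ⟨le_f_quality hd hk (sq_nonneg b) (marginal₁_cloner a b hab),
      le_f_quality hd hk (sq_nonneg a) (marginal₂_cloner a b hab)⟩

/-- Measure in the basis and prepare a different basis state: coherences are destroyed and no
outcome is reproduced, so every term of the fidelity vanishes. -/
lemma exists_channel_fidelity_zero (hd : 2 ≤ d) :
    ∃ T : CloningMap d, IsChannel T ∧ qualities .fidelity T = (0, 0) := by
  have : Nontrivial (Fin d) := Fin.nontrivial_iff_two_le.2 hd
  choose π hπ using fun i : Fin d => exists_ne i
  have key : ∀ L : Matrix (Fin d) (Fin d) ℂ →ₗ[ℂ] Matrix (Fin d) (Fin d) ℂ,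
      (∀ X, L X = ∑ k, Matrix.single (π k) (π k) (X k k)) → quality .fidelity L = 0 := by
    intro L hL
    have h0 : ∀ i j, L (Matrix.single i j 1) i j = 0 := fun i j => by
      rw [hL, Matrix.sum_apply]
      refine Finset.sum_eq_zero fun k _ => ?_
      by_cases hk : k = i
      · subst hk; simp [Matrix.single_apply, hπ]
      · simp [Matrix.single_apply, Ne.symm hk]
    rw [quality_fidelity]
    simp [h0]
  exact ⟨measurePrepare π, isChannel_measurePrepare π, by
    rw [qualities, key _ (marginal₁_measurePrepare π), key _ (marginal₂_measurePrepare π)]⟩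

lemma region_fidelity (hd : 2 ≤ d) : region d .fidelity = fidelitySet d := by
  apply Set.Subset.antisymm
  · rintro z ⟨-, -, T, hT, rfl⟩
    exact qualities_fidelity_mem hd hT
  · intro z hz
    refine ⟨hz.1, hz.2.1, ?_⟩
    obtain ⟨p, ⟨hp₁, hp₂, hp⟩, t, ht0, ht1, rfl⟩ := exists_curve_smul hd hz
    obtain ⟨T, hT, hq, -⟩ := exists_channel_of_boundary hd hp₁ hp₂ hp
    obtain ⟨T₀, hT₀, hq₀⟩ := exists_channel_fidelity_zero hd
    refine ⟨t • T + (1 - t) • T₀, hT.convex hT₀ ht0 (sub_nonneg.2 ht1) (by ring), ?_⟩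
    rw [qualities, Prod.mk.injEq] at hq hq₀
    rw [qualities, marginal₁_combination, marginal₂_combination, quality_fidelity_combination,
      quality_fidelity_combination, hq.1, hq.2, hq₀.1, hq₀.2]
    simp [f, Prod.ext_iff]

/-- A dominated point lies below a curve point, whose cloner is at least as good in both
coordinates; degrading the two clones separately then gives the point exactly. -/
lemma region_eq_dominatedSet (hd : 2 ≤ d) {k : Merit} (hk : k ≠ .fidelity) :
    region d k = dominatedSet d k := by
  apply Set.Subset.antisymm
  · rintro z ⟨h₁, h₂, T, hT, rfl⟩
    exact ⟨h₁, h₂, _, qualities_fidelity_mem hd hT, f_quality_le hd hk hT.marginal₁,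
      f_quality_le hd hk hT.marginal₂⟩
  · intro x hx
    obtain ⟨p, ⟨hp₁, hp₂, hp⟩, h₁, h₂⟩ := exists_curve_ge hd k hx
    obtain ⟨T, hT, -, hq⟩ := exists_channel_of_boundary hd hp₁ hp₂ hp
    have hs := one_le_slope hd k
    have mono : ∀ a b : ℝ, f d k a ≤ f d k b → a ≤ b := fun a b h => by
      rw [f_eq_slope, f_eq_slope] at h; by_contra! h'; nlinarith
    exact ⟨hx.1, hx.2.1, exists_lower hd hk hT hx.1 (h₁.trans (mono _ _ (hq k hk).1)) hx.2.1
      (h₂.trans (mono _ _ (hq k hk).2))⟩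

lemma region_eq_closedForm (hd : 2 ≤ d) (k : Merit) : region d k = closedForm d k := by
  by_cases hk : k = .fidelity
  · rw [hk, region_fidelity hd, closedForm_fidelity hd]
  · rw [region_eq_dominatedSet hd hk]
    exact (dominatedSet_subset_closedForm hd hk).antisymm (closedForm_subset_dominatedSet hd k)

lemma qualities_nonneg (hd : 2 ≤ d) {k : Merit} (hk : k ≠ .frobenius) {T : CloningMap d}
    (hT : IsChannel T) : 0 ≤ (qualities k T).1 ∧ 0 ≤ (qualities k T).2 := by
  by_cases hf : k = .fidelity
  · subst hf
    have h := qualities_fidelity_mem hd hT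
    exact ⟨h.1, h.2.1⟩
  · exact ⟨quality_nonneg (by omega) hf hk hT.marginal₁, quality_nonneg (by omega) hf hk hT.marginal₂⟩

lemma qualities_le_one (hd : 2 ≤ d) (k : Merit) {T : CloningMap d} (hT : IsChannel T) :
    (qualities k T).1 ≤ 1 ∧ (qualities k T).2 ≤ 1 := by
  by_cases hf : k = .fidelity
  · subst hf
    have h := qualities_fidelity_mem hd hT
    exact ⟨fst_le_one_of_mem_fidelitySet hd h, snd_le_one_of_mem_fidelitySet hd h⟩
  · exact ⟨quality_le_one (by omega) hf _, quality_le_one (by omega) hf _⟩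

lemma otherQuality_le (hd : 2 ≤ d) {k : Merit} {z : ℝ × ℝ} (hz : z ∈ region d k) :
    (z.1 = 1 → otherQuality d k ≤ z.2) ∧ (z.2 = 1 → otherQuality d k ≤ z.1) := by
  by_cases hf : k = .fidelity
  · subst hf
    rw [region_fidelity hd] at hz
    exact ⟨fun h => (snd_eq_of_mem_fidelitySet (swap_mem_fidelitySet hz) h).ge,
      fun h => (snd_eq_of_mem_fidelitySet hz h).ge⟩
  · rw [otherQuality_of_ne hf]
    exact ⟨fun _ => hz.2.1, fun _ => hz.1⟩

end Region

end QuantumCloning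

theorem corollary1 (d : ℕ) (hd : 2 ≤ d) :
    (∀ k : QuantumCloning.Merit,
      QuantumCloning.region d k = QuantumCloning.closedForm d k) ∧
    (∀ k : QuantumCloning.Merit, k ≠ QuantumCloning.Merit.frobenius →
      ∀ T : QuantumCloning.CloningMap d, QuantumCloning.IsChannel T →
        0 ≤ (QuantumCloning.qualities k T).1 ∧ 0 ≤ (QuantumCloning.qualities k T).2) ∧
    (∀ k : QuantumCloning.Merit,
      QuantumCloning.xmax₁ d k ∈ QuantumCloning.region d k ∧
      QuantumCloning.xmax₂ d k ∈ QuantumCloning.region d k ∧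
      (∀ T : QuantumCloning.CloningMap d, QuantumCloning.IsChannel T →
        (QuantumCloning.qualities k T).1 ≤ (QuantumCloning.xmax₁ d k).1 ∧
        (QuantumCloning.qualities k T).2 ≤ (QuantumCloning.xmax₂ d k).2) ∧
      (∀ z ∈ QuantumCloning.region d k,
        (z.1 = (QuantumCloning.xmax₁ d k).1 → (QuantumCloning.xmax₁ d k).2 ≤ z.2) ∧
        (z.2 = (QuantumCloning.xmax₂ d k).2 → (QuantumCloning.xmax₂ d k).1 ≤ z.1))) := by
  refine ⟨QuantumCloning.region_eq_closedForm hd,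
    fun k hk T hT => QuantumCloning.qualities_nonneg hd hk hT, fun k => ⟨?_, ?_,
      fun T hT => QuantumCloning.qualities_le_one hd k hT,
      fun z hz => QuantumCloning.otherQuality_le hd hz⟩⟩
  · rw [QuantumCloning.region_eq_closedForm hd]
    exact subset_convexHull ℝ _ (Or.inl (Or.inr (Or.inl rfl)))
  · rw [QuantumCloning.region_eq_closedForm hd]
    exact subset_convexHull ℝ _ (Or.inl (Or.inr (Or.inr rfl)))
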